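/- Let $(M,J)$ be an almost complex manifold of real dimension $2m$, where $M$ is a compact connected smooth manifold without boundary and $J$ is a smooth endomorphism field of $TM$ with $J^2=-\mathrm{Id}$. Let $g$ be any Riemannian metric on $M$ compatible with $J$, i.e. $g(J\cdot,J\cdot)=g$. Write $A^k$ for the space of smooth complex-valued $k$-forms on $M$, let $J$ act on $A^k$ by $(J\alpha)(v_1,\dots,v_k)=\alpha(Jv_1,\dots,Jv_k)$, put $d^c:=J^{-1}dJ$, and let $P^*$ denote the formal adjoint of a differential operator $P$ with respect to the $L^2$ Hermitian product defined by $g$. Let \[ \Delta_{d+d^c}=dd^c(dd^c)^*+(dd^c)^*dd^c+d^*d^c(d^*d^c)^*+(d^*d^c)^*d^*d^c+d^*d+(d^c)^*d^c , \] $\mathcal H^1_{d+d^c}:=A^1\cap\ker\Delta_{d+d^c}$ and $h^1_{d+d^c}:=\dim_{\mathbb C}\mathcal H^1_{d+d^c}$, and let $b_1=\dim_{\mathbb C}H^1_{dR}(M;\mathbb C)$ be the first Betti number of $M$. Then: 1. every $\alpha\in\mathcal H^1_{d+d^c}$ is $d$-closed, and the linear map $\mathcal H^1_{d+d^c}\to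 H^1_{dR}(M;\mathbb C)$, $\alpha\mapsto[\alpha]$, is injective; 2. $h^1_{d+d^c}\le b_1$; 3. if $b_1\in\{0,1\}$, then $h^1_{d+d^c}=0$. -/

import Mathlib

open scoped Manifold ContDiff Topology
open Bundle Set

namespace AlmostComplex

abbrev Coord (n : ℕ) : Type := EuclideanSpace ℝ (Fin n)

noncomputable section

/-- The `i`-th standard basis vector of `ℝⁿ`. -/
def stdVec {n : ℕ} (i : Fin n) : Coord n := EuclideanSpace.single i 1

lemma alt_expand {n k : ℕ} (φ : Coord n [⋀^Fin k]→L[ℝ] ℂ) (w : Fin k → Coord n) :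
    φ w = ∑ I : Fin k → Fin n, (∏ a, w a (I a)) • φ (fun a => stdVec (I a)) := by
  have h : w = fun a => ∑ i, w a i • stdVec i := by
    funext a
    ext j
    simp [stdVec, Finset.sum_apply, Pi.single_apply]
  conv_lhs => rw [h]
  have h2 := φ.toMultilinearMap.map_sum (fun a i => w a i • (stdVec i : Coord n))
  refine h2.trans (Finset.sum_congr rfl fun I _ => ?_)
  exact φ.toMultilinearMap.map_smul_univ (fun a => w a (I a)) (fun a => stdVec (I a))

lemma contDiffOn_alt_apply {n k : ℕ} {D : Type*} [NormedAddCommGroup D] [NormedSpace ℝ D]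
    {f : D → Coord n [⋀^Fin k]→L[ℝ] ℂ} {s : Set D} {w : Fin k → D → Coord n}
    (hf : ContDiffOn ℝ ∞ f s) (hw : ∀ a, ContDiffOn ℝ ∞ (w a) s) :
    ContDiffOn ℝ ∞ (fun y => f y (fun a => w a y)) s := by
  refine ContDiffOn.congr ?_ fun y _ => alt_expand (f y) (fun a => w a y)
  refine ContDiffOn.sum fun I _ => ?_
  have h1 : ContDiffOn ℝ ∞ (fun y => ∏ a, w a y (I a)) s :=
    contDiffOn_prod (f := fun a y => w a y (I a)) fun a _ =>
      (EuclideanSpace.proj (𝕜 := ℝ) (I a)).contDiff.comp_contDiffOn (hw a)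
  have h2 : ContDiffOn ℝ ∞ (fun y => f y fun a => stdVec (I a)) s :=
    (ContinuousAlternatingMap.apply ℝ (Coord n) ℂ
      (fun a => stdVec (I a))).contDiff.comp_contDiffOn hf
  exact h1.smul h2

lemma contDiffOn_alt_of_apply {n k : ℕ} {D : Type*} [NormedAddCommGroup D] [NormedSpace ℝ D]
    {f : D → Coord n [⋀^Fin k]→L[ℝ] ℂ} {s : Set D}
    (hf : ∀ v, ContDiffOn ℝ ∞ (fun y => f y v) s) : ContDiffOn ℝ ∞ f s := by
  let Φ : (Coord n [⋀^Fin k]→L[ℝ] ℂ) →ₗ[ℝ] ((Fin k → Fin n) → ℂ) :=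
    { toFun := fun φ I => φ (fun a => stdVec (I a))
      map_add' := fun _ _ => rfl
      map_smul' := fun _ _ => rfl }
  have hinj : LinearMap.ker Φ = ⊥ := by
    rw [LinearMap.ker_eq_bot']
    intro φ hφ
    ext w
    rw [alt_expand]
    refine Finset.sum_eq_zero fun I _ => ?_
    rw [show φ (fun a => stdVec (I a)) = 0 from congrFun hφ I, smul_zero]
  obtain ⟨Ψ, hΨ⟩ := Φ.exists_leftInverse_of_injective hinj
  have h : f = fun y => Ψ.toContinuousLinearMap (Φ (f y)) := by
    funext y
    exact (DFunLike.congr_fun hΨ (f y)).symm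
  rw [h]
  exact Ψ.toContinuousLinearMap.contDiff.comp_contDiffOn (contDiffOn_pi.2 fun I => hf _)

lemma contDiffOn_alt_comp {n k : ℕ} {D : Type*} [NormedAddCommGroup D] [NormedSpace ℝ D]
    {f : D → Coord n [⋀^Fin k]→L[ℝ] ℂ} {s : Set D} {A : D → Coord n →L[ℝ] Coord n}
    (hf : ContDiffOn ℝ ∞ f s) (hA : ∀ v, ContDiffOn ℝ ∞ (fun y => A y v) s) :
    ContDiffOn ℝ ∞ (fun y => (f y).compContinuousLinearMap (A y)) s :=
  contDiffOn_alt_of_apply fun v => contDiffOn_alt_apply (w := fun a y => A y (v a)) hf fun a => hA (v a)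

set_option synthInstance.maxHeartbeats 200000 in
lemma contDiffOn_extDeriv {E F : Type*} [NormedAddCommGroup E] [NormedSpace ℝ E]
    [NormedAddCommGroup F] [NormedSpace ℝ F] {k : ℕ} {f : E → E [⋀^Fin k]→L[ℝ] F} {s : Set E}
    (hs : IsOpen s) (hf : ContDiffOn ℝ ∞ f s) : ContDiffOn ℝ ∞ (extDeriv f) s :=
  (ContinuousAlternatingMap.alternatizeUncurryFinCLM (n := k) ℝ E F).contDiff.comp_contDiffOn
    (hf.fderiv_of_isOpen hs (by simp))

lemma extDeriv_complex_smul {E : Type*} [NormedAddCommGroup E] [NormedSpace ℝ E] {k : ℕ}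
    {f : E → E [⋀^Fin k]→L[ℝ] ℂ} {x : E} (z : ℂ) (h : DifferentiableAt ℝ f x) :
    extDeriv (z • f) x = z • extDeriv f x := by
  ext v
  rw [extDeriv_apply (h.const_smul z), ContinuousAlternatingMap.smul_apply, extDeriv_apply h,
    Finset.smul_sum]
  refine Finset.sum_congr rfl fun i _ => ?_
  have h' : DifferentiableAt ℝ (fun y => f y (i.removeNth v)) x :=
    (ContinuousAlternatingMap.apply ℝ E ℂ (i.removeNth v)).differentiableAt.comp x h
  rw [smul_comm z]
  congr 1
  have := fderiv_const_smul h' z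
  exact DFunLike.congr_fun this (v i)

section Forms

variable {n : ℕ} {M : Type*} [TopologicalSpace M] [ChartedSpace (Coord n) M]

/-- A (not necessarily smooth) complex-valued `k`-form: a real alternating `k`-linear map
`(T_x M)^k → ℂ` at each point `x`. -/
abbrev RawForm (n : ℕ) (M : Type*) [TopologicalSpace M] [ChartedSpace (Coord n) M] (k : ℕ) :
    Type _ :=
  (x : M) → TangentSpace (𝓡 n) x [⋀^Fin k]→L[ℝ] ℂ

/-- The differential at `y` of the inverse of the chart `φ_c`; it sends the `i`-th standard basis
vector to the coordinate vector `∂/∂y_i`. -/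
def chartFrame (c : M) (y : Coord n) :
    Coord n →L[ℝ] TangentSpace (𝓡 n) ((extChartAt (𝓡 n) c).symm y) :=
  mfderiv 𝓘(ℝ, Coord n) (𝓡 n) (extChartAt (𝓡 n) c).symm y

/-- The expression of a form in the chart `φ_c`, i.e. its pullback under `φ_c⁻¹`. -/
def chartRep {k : ℕ} (c : M) (α : RawForm n M k) (y : Coord n) : Coord n [⋀^Fin k]→L[ℝ] ℂ :=
  (α ((extChartAt (𝓡 n) c).symm y)).compContinuousLinearMap (chartFrame c y)

lemma chartRep_add {k : ℕ} (c : M) (α β : RawForm n M k) :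
    chartRep c (α + β) = chartRep c α + chartRep c β := by
  ext y v; rfl

lemma chartRep_smul {k : ℕ} (c : M) (z : ℂ) (α : RawForm n M k) :
    chartRep c (z • α) = z • chartRep c α := by
  ext y v; rfl

lemma chartRep_zero {k : ℕ} (c : M) :
    chartRep c (0 : RawForm n M k) = 0 := by
  ext y v; rfl

/-- The space `A^k` of smooth complex `k`-forms on `M`: the expression of the form in every chart
is smooth. -/
def SmoothForm (n : ℕ) (M : Type*) [TopologicalSpace M] [ChartedSpace (Coord n) M] (k : ℕ) :
    Submodule ℂ (RawForm n M k) where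
  carrier := {α | ∀ c : M, ContDiffOn ℝ ∞ (chartRep c α) (extChartAt (𝓡 n) c).target}
  zero_mem' c := by
    rw [chartRep_zero]; exact contDiffOn_const
  add_mem' ha hb c := by
    rw [chartRep_add]; exact (ha c).add (hb c)
  smul_mem' z α ha c := by
    rw [chartRep_smul]; exact (ha c).const_smul z

instance {k : ℕ} : AddCommGroup (SmoothForm n M k) := Submodule.addCommGroup _

instance {k : ℕ} : Module ℂ (SmoothForm n M k) := Submodule.module _

/-- The exterior derivative: at `x`, take the exterior derivative of the expression of the form
in the chart at `x`, and pull it back to `T_x M` by the differential of the chart. -/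
def rawExtDeriv {k : ℕ} (α : RawForm n M k) : RawForm n M (k + 1) := fun x =>
  (extDeriv (chartRep x α) (extChartAt (𝓡 n) x x)).compContinuousLinearMap
    (mfderiv (𝓡 n) 𝓘(ℝ, Coord n) (extChartAt (𝓡 n) x) x)

lemma chartRep_eq {k : ℕ} (c : M) (α : RawForm n M k) {y : Coord n} {x : M}
    (h : (extChartAt (𝓡 n) c).symm y = x) :
    chartRep c α y = (α x).compContinuousLinearMap
      (mfderiv 𝓘(ℝ, Coord n) (𝓡 n) (extChartAt (𝓡 n) c).symm y : Coord n →L[ℝ] Coord n) := by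
  subst h; rfl

lemma eventually_transition (c p : M) {y : Coord n} (hy : y ∈ (extChartAt (𝓡 n) c).target)
    (hp : (extChartAt (𝓡 n) c).symm y ∈ (extChartAt (𝓡 n) p).source) :
    ∀ᶠ z in 𝓝 y, z ∈ (extChartAt (𝓡 n) c).target ∧
      (extChartAt (𝓡 n) c).symm z ∈ (extChartAt (𝓡 n) p).source := by
  have h1 := (isOpen_extChartAt_target (I := 𝓡 n) c).mem_nhds hy
  have h2 := (continuousAt_extChartAt_symm'' (I := 𝓡 n) hy).preimage_mem_nhds
    ((isOpen_extChartAt_source (I := 𝓡 n) p).mem_nhds hp)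
  filter_upwards [h1, h2] with z hz1 hz2 using ⟨hz1, hz2⟩

lemma differentiableAt_chartRep {k : ℕ} {α : RawForm n M k} (hα : α ∈ SmoothForm n M k) (x : M) :
    DifferentiableAt ℝ (chartRep x α) (extChartAt (𝓡 n) x x) :=
  ((hα x).contDiffAt ((isOpen_extChartAt_target (I := 𝓡 n) x).mem_nhds
    (mem_extChartAt_target (I := 𝓡 n) x))).differentiableAt (by simp)

variable [IsManifold (𝓡 n) ∞ M]

lemma mfderiv_symm_comp_mfderiv (p : M) {x : M} (hx : x ∈ (extChartAt (𝓡 n) p).source) :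
    (mfderiv 𝓘(ℝ, Coord n) (𝓡 n) (extChartAt (𝓡 n) p).symm (extChartAt (𝓡 n) p x)) ∘L
      (mfderiv (𝓡 n) 𝓘(ℝ, Coord n) (extChartAt (𝓡 n) p) x) = ContinuousLinearMap.id ℝ _ := by
  have : IsManifold (𝓡 n) 1 M := IsManifold.of_le (n := ∞) (by simp)
  have := mfderivWithin_extChartAt_symm_comp_mfderiv_extChartAt' (I := 𝓡 n) hx
  rwa [ModelWithCorners.range_eq_univ, mfderivWithin_univ] at this

lemma mdifferentiableAt_symm (c : M) {y : Coord n} (hy : y ∈ (extChartAt (𝓡 n) c).target) :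
    MDifferentiableAt 𝓘(ℝ, Coord n) (𝓡 n) (extChartAt (𝓡 n) c).symm y := by
  have : IsManifold (𝓡 n) 1 M := IsManifold.of_le (n := ∞) (by simp)
  have := mdifferentiableWithinAt_extChartAt_symm (I := 𝓡 n) hy
  rwa [ModelWithCorners.range_eq_univ, mdifferentiableWithinAt_univ] at this

lemma fderiv_transition (c p : M) {y : Coord n} (hy : y ∈ (extChartAt (𝓡 n) c).target)
    (hp : (extChartAt (𝓡 n) c).symm y ∈ (extChartAt (𝓡 n) p).source) :
    fderiv ℝ (extChartAt (𝓡 n) p ∘ (extChartAt (𝓡 n) c).symm) y =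
      (mfderiv (𝓡 n) 𝓘(ℝ, Coord n) (extChartAt (𝓡 n) p) ((extChartAt (𝓡 n) c).symm y)) ∘L
        (chartFrame c y) := by
  have : IsManifold (𝓡 n) 1 M := IsManifold.of_le (n := ∞) (by simp)
  rw [← mfderiv_eq_fderiv]
  refine mfderiv_comp y (mdifferentiableAt_extChartAt ?_) (mdifferentiableAt_symm c hy)
  rwa [extChartAt_source] at hp

lemma contDiffAt_transition (c p : M) {y : Coord n} (hy : y ∈ (extChartAt (𝓡 n) c).target)
    (hp : (extChartAt (𝓡 n) c).symm y ∈ (extChartAt (𝓡 n) p).source) :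
    ContDiffAt ℝ ∞ (extChartAt (𝓡 n) p ∘ (extChartAt (𝓡 n) c).symm) y := by
  have h := contDiffWithinAt_ext_coord_change (n := ∞) (I := 𝓡 n) p c (y := y)
    (⟨hy, hp⟩)
  rwa [ModelWithCorners.range_eq_univ, contDiffWithinAt_univ] at h

lemma chartRep_transition {k : ℕ} (α : RawForm n M k) (c p : M) {y : Coord n}
    (hy : y ∈ (extChartAt (𝓡 n) c).target)
    (hp : (extChartAt (𝓡 n) c).symm y ∈ (extChartAt (𝓡 n) p).source) :
    chartRep c α y =
      (chartRep p α ((extChartAt (𝓡 n) p ∘ (extChartAt (𝓡 n) c).symm) y)).compContinuousLinearMap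
        (fderiv ℝ (extChartAt (𝓡 n) p ∘ (extChartAt (𝓡 n) c).symm) y) := by
  have hx := (extChartAt (𝓡 n) p).left_inv hp
  have hid := mfderiv_symm_comp_mfderiv p hp
  rw [fderiv_transition c p hy hp, Function.comp_apply, chartRep_eq p α hx]
  ext v
  refine congrArg (α ((extChartAt (𝓡 n) c).symm y)) (funext fun i => ?_)
  exact (DFunLike.congr_fun hid (chartFrame c y (v i))).symm

/-- The exterior derivative is computed in every chart by the exterior derivative of the
coordinate expression. -/
lemma chartRep_rawExtDeriv {k : ℕ} {α : RawForm n M k} (hα : α ∈ SmoothForm n M k) (c : M)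
    {y : Coord n} (hy : y ∈ (extChartAt (𝓡 n) c).target) :
    chartRep c (rawExtDeriv α) y = extDeriv (chartRep c α) y := by
  set p := (extChartAt (𝓡 n) c).symm y with hpdef
  have hp : (extChartAt (𝓡 n) c).symm y ∈ (extChartAt (𝓡 n) p).source :=
    mem_extChartAt_source (I := 𝓡 n) p
  have hev : chartRep c α =ᶠ[𝓝 y] fun z =>
      (chartRep p α ((extChartAt (𝓡 n) p ∘ (extChartAt (𝓡 n) c).symm) z)).compContinuousLinearMap
        (fderiv ℝ (extChartAt (𝓡 n) p ∘ (extChartAt (𝓡 n) c).symm) z) := by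
    filter_upwards [eventually_transition c p hy hp] with z hz
    exact chartRep_transition α c p hz.1 hz.2
  have hty : (extChartAt (𝓡 n) p ∘ (extChartAt (𝓡 n) c).symm) y ∈ (extChartAt (𝓡 n) p).target :=
    (extChartAt (𝓡 n) p).map_source hp
  have hdiff : DifferentiableAt ℝ (chartRep p α)
      ((extChartAt (𝓡 n) p ∘ (extChartAt (𝓡 n) c).symm) y) :=
    ((hα p).contDiffAt ((isOpen_extChartAt_target (I := 𝓡 n) p).mem_nhds hty)).differentiableAt
      (by simp)
  rw [hev.extDeriv_eq, extDeriv_pullback hdiff (contDiffAt_transition c p hy hp)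
      (by rw [minSmoothness_of_isRCLikeNormedField]; exact ENat.LEInfty.out),
    fderiv_transition c p hy hp]
  rfl

lemma rawExtDeriv_mem {k : ℕ} {α : RawForm n M k} (hα : α ∈ SmoothForm n M k) :
    rawExtDeriv α ∈ SmoothForm n M (k + 1) := by
  intro c
  have hopen := isOpen_extChartAt_target (I := 𝓡 n) c
  have h1 := contDiffOn_extDeriv hopen (hα c)
  exact h1.congr fun y hy => chartRep_rawExtDeriv hα c hy

/-- The exterior derivative `d : A^k → A^{k+1}`. -/
def extD (k : ℕ) : SmoothForm n M k →ₗ[ℂ] SmoothForm n M (k + 1) where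
  toFun α := ⟨rawExtDeriv α.1, rawExtDeriv_mem α.2⟩
  map_add' α β := by
    ext x v
    simp only [rawExtDeriv, Submodule.coe_add, chartRep_add, Pi.add_apply]
    rw [extDeriv_add (differentiableAt_chartRep α.2 x) (differentiableAt_chartRep β.2 x)]
    rfl
  map_smul' z α := by
    ext x v
    simp only [rawExtDeriv, Submodule.coe_smul, chartRep_smul, Pi.smul_apply, RingHom.id_apply]
    rw [extDeriv_complex_smul z (differentiableAt_chartRep α.2 x)]
    rfl


/-- An almost complex structure on `M`: a smooth field `J` of endomorphisms of the tangent bundle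
with `J² = -1`. -/
structure AlmostComplexStructure (n : ℕ) (M : Type*) [TopologicalSpace M]
    [ChartedSpace (Coord n) M] [IsManifold (𝓡 n) ∞ M] where
  toFun : (x : M) → TangentSpace (𝓡 n) x →L[ℝ] TangentSpace (𝓡 n) x
  sq_eq_neg : ∀ (x : M) (v : TangentSpace (𝓡 n) x), toFun x (toFun x v) = -v
  contMDiff : ContMDiff (𝓡 n) ((𝓡 n).prod 𝓘(ℝ, Coord n →L[ℝ] Coord n)) ∞
    (fun x => TotalSpace.mk' (Coord n →L[ℝ] Coord n)
      (E := fun x : M => TangentSpace (𝓡 n) x →L[ℝ] TangentSpace (𝓡 n) x) x (toFun x))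

lemma trivialization_apply (c : M) {x : M} (hx : x ∈ (extChartAt (𝓡 n) c).source)
    (v : TangentSpace (𝓡 n) x) :
    ((trivializationAt (Coord n) (TangentSpace (𝓡 n)) c) ⟨x, v⟩).2 =
      mfderiv (𝓡 n) 𝓘(ℝ, Coord n) (extChartAt (𝓡 n) c) x v := by
  have : IsManifold (𝓡 n) 1 M := IsManifold.of_le (n := ∞) (by simp)
  have hx' : x ∈ (chartAt (Coord n) c).source := by rwa [extChartAt_source] at hx
  have h := TangentBundle.continuousLinearMapAt_trivializationAt (I := 𝓡 n) hx'
  refine Eq.trans ?_ (DFunLike.congr_fun h v)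
  rw [Trivialization.continuousLinearMapAt_apply, Trivialization.linearMapAt_apply,
    if_pos (by simpa using hx')]

lemma mfderiv_comp_chartFrame (c : M) {y : Coord n} (hy : y ∈ (extChartAt (𝓡 n) c).target)
    (v : Coord n) :
    mfderiv (𝓡 n) 𝓘(ℝ, Coord n) (extChartAt (𝓡 n) c) ((extChartAt (𝓡 n) c).symm y)
      (chartFrame c y v) = v := by
  have : IsManifold (𝓡 n) 1 M := IsManifold.of_le (n := ∞) (by simp)
  have h := mfderiv_extChartAt_comp_mfderivWithin_extChartAt_symm (I := 𝓡 n) hy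
  rw [ModelWithCorners.range_eq_univ, mfderivWithin_univ] at h
  exact DFunLike.congr_fun h v

lemma contMDiffOn_chartFrame (c : M) (v : Coord n) :
    ContMDiffOn 𝓘(ℝ, Coord n) ((𝓡 n).prod 𝓘(ℝ, Coord n)) ∞
      (fun y => TotalSpace.mk' (Coord n) (E := fun x : M => TangentSpace (𝓡 n) x)
        ((extChartAt (𝓡 n) c).symm y) (chartFrame c y v)) (extChartAt (𝓡 n) c).target := by
  have hmaps : MapsTo (fun y => TotalSpace.mk' (Coord n) (E := fun x : M => TangentSpace (𝓡 n) x)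
        ((extChartAt (𝓡 n) c).symm y) (chartFrame c y v)) (extChartAt (𝓡 n) c).target
        (trivializationAt (Coord n) (TangentSpace (𝓡 n)) c).source := by
    intro y hy
    have := (extChartAt (𝓡 n) c).map_target hy
    rw [extChartAt_source] at this
    simpa [Trivialization.mem_source] using this
  rw [Trivialization.contMDiffOn_iff hmaps]
  refine ⟨contMDiffOn_extChartAt_symm c, ?_⟩
  refine (contMDiffOn_const (c := v)).congr fun y hy => ?_
  exact (trivialization_apply c ((extChartAt (𝓡 n) c).map_target hy) _).trans
    (mfderiv_comp_chartFrame c hy v)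

/-- The matrix of `J` in the chart, as an endomorphism of `ℝⁿ`. -/
def AlmostComplexStructure.inChart (J : AlmostComplexStructure n M) (c : M) (y : Coord n) :
    Coord n →L[ℝ] Coord n :=
  (mfderiv (𝓡 n) 𝓘(ℝ, Coord n) (extChartAt (𝓡 n) c) ((extChartAt (𝓡 n) c).symm y)) ∘L
    (J.toFun ((extChartAt (𝓡 n) c).symm y)) ∘L (chartFrame c y)

lemma AlmostComplexStructure.contDiffOn_inChart (J : AlmostComplexStructure n M) (c : M)
    (v : Coord n) :
    ContDiffOn ℝ ∞ (fun y => J.inChart c y v) (extChartAt (𝓡 n) c).target := by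
  have h1 : ContMDiffOn 𝓘(ℝ, Coord n) ((𝓡 n).prod 𝓘(ℝ, Coord n →L[ℝ] Coord n)) ∞
      (fun y => TotalSpace.mk' (Coord n →L[ℝ] Coord n)
        (E := fun x : M => TangentSpace (𝓡 n) x →L[ℝ] TangentSpace (𝓡 n) x)
        ((extChartAt (𝓡 n) c).symm y) (J.toFun ((extChartAt (𝓡 n) c).symm y)))
      (extChartAt (𝓡 n) c).target :=
    J.contMDiff.comp_contMDiffOn (contMDiffOn_extChartAt_symm c)
  have h2 := h1.clm_bundle_apply (contMDiffOn_chartFrame c v)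
  have hmaps : MapsTo (fun y => TotalSpace.mk' (Coord n) (E := fun x : M => TangentSpace (𝓡 n) x)
        ((extChartAt (𝓡 n) c).symm y)
        (J.toFun ((extChartAt (𝓡 n) c).symm y) (chartFrame c y v))) (extChartAt (𝓡 n) c).target
        (trivializationAt (Coord n) (TangentSpace (𝓡 n)) c).source := by
    intro y hy
    have := (extChartAt (𝓡 n) c).map_target hy
    rw [extChartAt_source] at this
    simpa [Trivialization.mem_source] using this
  rw [Trivialization.contMDiffOn_iff hmaps] at h2
  rw [← contMDiffOn_iff_contDiffOn]
  refine h2.2.congr fun y hy => ?_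
  exact (trivialization_apply c ((extChartAt (𝓡 n) c).map_target hy) _).symm

/-- The action of `J` on forms by duality, `(Jα)(v₁, …, v_k) = α(Jv₁, …, Jv_k)`. -/
def AlmostComplexStructure.rawAct (J : AlmostComplexStructure n M) {k : ℕ} (α : RawForm n M k) :
    RawForm n M k := fun x => (α x).compContinuousLinearMap (J.toFun x)

lemma AlmostComplexStructure.rawAct_mem (J : AlmostComplexStructure n M) {k : ℕ}
    {α : RawForm n M k} (hα : α ∈ SmoothForm n M k) : J.rawAct α ∈ SmoothForm n M k := by
  intro c
  refine (contDiffOn_alt_comp (hα c) (J.contDiffOn_inChart c)).congr fun y hy => ?_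
  have hsrc := (extChartAt (𝓡 n) c).map_target hy
  have hid := mfderiv_symm_comp_mfderiv c hsrc
  rw [(extChartAt (𝓡 n) c).right_inv hy] at hid
  ext v
  refine congrArg (α ((extChartAt (𝓡 n) c).symm y)) (funext fun i => ?_)
  exact (DFunLike.congr_fun hid
    (J.toFun ((extChartAt (𝓡 n) c).symm y) (chartFrame c y (v i)))).symm

/-- The action `J : A^k → A^k` of an almost complex structure on smooth forms. -/
def AlmostComplexStructure.act (J : AlmostComplexStructure n M) (k : ℕ) :
    SmoothForm n M k →ₗ[ℂ] SmoothForm n M k where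
  toFun α := ⟨J.rawAct α.1, J.rawAct_mem α.2⟩
  map_add' _ _ := rfl
  map_smul' _ _ := rfl

lemma AlmostComplexStructure.act_act (J : AlmostComplexStructure n M) (k : ℕ)
    (α : SmoothForm n M k) : J.act k (J.act k α) = (-1 : ℂ) ^ k • α := by
  ext x v
  change α.1 x (fun i => J.toFun x (J.toFun x (v i))) = (-1 : ℂ) ^ k • α.1 x v
  have h : (fun i => J.toFun x (J.toFun x (v i))) = fun i => (-1 : ℝ) • v i := by
    funext i; rw [J.sq_eq_neg]; simp
  rw [h]
  have := (α.1 x).toMultilinearMap.map_smul_univ (fun _ => (-1 : ℝ)) v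
  refine this.trans ?_
  simp [Finset.prod_const]

/-- The automorphism `J` of `A^k`, whose inverse is `(-1)^k J`. -/
def AlmostComplexStructure.actEquiv (J : AlmostComplexStructure n M) (k : ℕ) :
    SmoothForm n M k ≃ₗ[ℂ] SmoothForm n M k :=
  LinearEquiv.ofLinearMap (J.act k) ((-1 : ℂ) ^ k • J.act k)
    (by
      ext1 α
      simp only [LinearMap.comp_apply, LinearMap.smul_apply, map_smul, J.act_act, smul_smul,
        ← mul_pow, LinearMap.id_apply]
      simp)
    (by
      ext1 α
      simp only [LinearMap.comp_apply, LinearMap.smul_apply, J.act_act, smul_smul,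
        ← mul_pow, LinearMap.id_apply]
      simp)

/-- The operator `d^c = J⁻¹ d J : A^k → A^{k+1}`. -/
def AlmostComplexStructure.dc (J : AlmostComplexStructure n M) (k : ℕ) :
    SmoothForm n M k →ₗ[ℂ] SmoothForm n M (k + 1) :=
  (J.actEquiv (k + 1)).symm.toLinearMap ∘ₗ extD k ∘ₗ (J.actEquiv k).toLinearMap

/-- A smooth Riemannian metric on `M`. -/
abbrev Metric (n : ℕ) (M : Type*) [TopologicalSpace M] [ChartedSpace (Coord n) M]
    [IsManifold (𝓡 n) ∞ M] : Type _ :=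
  ContMDiffRiemannianMetric (𝓡 n) ∞ (Coord n) (fun x : M => TangentSpace (𝓡 n) x)

/-- `g` is compatible with `J` if `g(J·, J·) = g`, equivalently if `ω(u, v) = g(Ju, v)` is
a `2`-form, which is then nondegenerate and satisfies `ω(·, J·) = g`. -/
def IsCompatible (J : AlmostComplexStructure n M) (g : Metric n M) : Prop :=
  ∀ (x : M) (v w : TangentSpace (𝓡 n) x), g.inner x (J.toFun x v) (J.toFun x w) = g.inner x v w

/-- The matrix `g_{ij}` of the metric in the chart `φ_c`. -/
def gram (g : Metric n M) (c : M) (y : Coord n) : Matrix (Fin n) (Fin n) ℝ :=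
  Matrix.of fun i j => g.inner ((extChartAt (𝓡 n) c).symm y)
    (chartFrame c y (stdVec i)) (chartFrame c y (stdVec j))

/-- The Hermitian inner product on complex `k`-forms on `ℝⁿ` induced by a positive definite
matrix `G`, that is `(1/k!) ∑ G^{i₁j₁} ⋯ G^{i_kj_k} α_{i₁…i_k} conj β_{j₁…j_k}`. -/
def formInner (G : Matrix (Fin n) (Fin n) ℝ) {k : ℕ} (α β : Coord n [⋀^Fin k]→L[ℝ] ℂ) : ℂ :=
  ((k.factorial : ℂ))⁻¹ * ∑ I : Fin k → Fin n, ∑ K : Fin k → Fin n,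
    ((∏ a, G⁻¹ (I a) (K a) : ℝ) : ℂ) * (α fun a => stdVec (I a)) *
      (starRingEnd ℂ) (β fun a => stdVec (K a))

lemma gram_pos (g : Metric n M) (c : M) {y : Coord n} (hy : y ∈ (extChartAt (𝓡 n) c).target) :
    (gram g c y).PosDef := by
  have hinj : ∀ v : Coord n, chartFrame c y v = 0 → v = 0 := by
    intro v hv
    rw [← mfderiv_comp_chartFrame c hy v, hv, map_zero]
    rfl
  rw [Matrix.posDef_iff_dotProduct_mulVec]
  refine ⟨?_, ?_⟩
  · ext i j
    exact g.symm _ _ _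
  · intro x hx
    set v : Coord n := ∑ i, x i • stdVec i with hv
    have hv0 : v ≠ 0 := by
      intro h
      apply hx
      funext j
      have := congrArg (fun w : Coord n => w j) h
      simpa [hv, stdVec, Pi.single_apply] using this
    have hp := g.pos _ _ (fun h => hv0 (hinj v h))
    refine hp.trans_eq ?_
    simp only [hv, map_sum, map_smul, sum_apply, smul_apply,
      dotProduct, Matrix.mulVec, gram, Matrix.of_apply, star_trivial, Finset.mul_sum, smul_eq_mul]
    rw [Finset.sum_comm]
    refine Finset.sum_congr rfl fun i _ => Finset.sum_congr rfl fun j _ => ?_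
    ring

lemma continuousOn_gram (g : Metric n M) (c : M) :
    ContinuousOn (gram g c) (extChartAt (𝓡 n) c).target := by
  refine continuousOn_pi.2 fun i => continuousOn_pi.2 fun j => ?_
  have h1 : ContMDiffOn 𝓘(ℝ, Coord n) ((𝓡 n).prod 𝓘(ℝ, Coord n →L[ℝ] Coord n →L[ℝ] ℝ)) ∞
      (fun y => TotalSpace.mk' (Coord n →L[ℝ] Coord n →L[ℝ] ℝ)
        (E := fun x : M => TangentSpace (𝓡 n) x →L[ℝ] TangentSpace (𝓡 n) x →L[ℝ] ℝ)
        ((extChartAt (𝓡 n) c).symm y) (g.inner ((extChartAt (𝓡 n) c).symm y)))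
      (extChartAt (𝓡 n) c).target :=
    g.contMDiff.comp_contMDiffOn (contMDiffOn_extChartAt_symm c)
  intro y hy
  have h2 : ContMDiffWithinAt 𝓘(ℝ, Coord n) ((𝓡 n).prod 𝓘(ℝ)) ∞
      (fun m ↦ TotalSpace.mk' ℝ (E := Bundle.Trivial M ℝ) ((extChartAt (𝓡 n) c).symm m)
        (g.inner ((extChartAt (𝓡 n) c).symm m) (chartFrame c m (stdVec i))
          (chartFrame c m (stdVec j)))) (extChartAt (𝓡 n) c).target y := by
    apply ContMDiffWithinAt.clm_bundle_apply₂ (F₁ := Coord n) (F₂ := Coord n)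
    · exact h1 y hy
    · exact contMDiffOn_chartFrame c _ y hy
    · exact contMDiffOn_chartFrame c _ y hy
  simp only [contMDiffWithinAt_totalSpace] at h2
  exact h2.2.continuousWithinAt

lemma continuousOn_formInner {s : Set (Coord n)} {G : Coord n → Matrix (Fin n) (Fin n) ℝ} {k : ℕ}
    {α β : Coord n → Coord n [⋀^Fin k]→L[ℝ] ℂ} (hG : ContinuousOn G s)
    (hdet : ∀ y ∈ s, (G y).det ≠ 0) (hα : ContinuousOn α s) (hβ : ContinuousOn β s) :
    ContinuousOn (fun y => formInner (G y) (α y) (β y)) s := by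
  have hinv : ∀ i j, ContinuousOn (fun y => (G y)⁻¹ i j) s := by
    intro i j
    simp only [Matrix.inv_def, Matrix.smul_apply, Ring.inverse_eq_inv', smul_eq_mul]
    refine ContinuousOn.mul (ContinuousOn.inv₀ ?_ hdet) ?_
    · exact (continuous_id.matrix_det).comp_continuousOn hG
    · exact ((continuous_id.matrix_adjugate).matrix_elem i j).comp_continuousOn hG
  have hev : ∀ (φ : Coord n → Coord n [⋀^Fin k]→L[ℝ] ℂ) (v : Fin k → Coord n),
      ContinuousOn φ s → ContinuousOn (fun y => φ y v) s := fun φ v h =>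
    (ContinuousAlternatingMap.apply ℝ (Coord n) ℂ v).continuous.comp_continuousOn h
  unfold formInner
  refine continuousOn_const.mul (continuousOn_finsetSum _ fun I _ =>
    continuousOn_finsetSum _ fun K _ => ?_)
  refine ((Complex.continuous_ofReal.comp_continuousOn
    (continuousOn_finsetProd _ fun a _ => hinv _ _)).mul (hev _ _ hα)).mul ?_
  exact Complex.continuous_conj.comp_continuousOn (hev _ _ hβ)

section Integration

variable [T2Space M] [CompactSpace M]

/-- A smooth partition of unity `(ρ_c)` on `M` subordinate to the charts `φ_c`. -/
def chartPartition (n : ℕ) (M : Type*) [TopologicalSpace M] [ChartedSpace (Coord n) M]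
    [IsManifold (𝓡 n) ∞ M] [T2Space M] [CompactSpace M] :
    SmoothPartitionOfUnity M (𝓡 n) M univ :=
  Classical.choose (SmoothPartitionOfUnity.exists_isSubordinate_chartAt_source (𝓡 n) M)

lemma chartPartition_sub (c : M) :
    tsupport (chartPartition n M c) ⊆ (extChartAt (𝓡 n) c).source := by
  rw [extChartAt_source]
  exact Classical.choose_spec
    (SmoothPartitionOfUnity.exists_isSubordinate_chartAt_source (𝓡 n) M) c

/-- The function `ρ_c ⟨α, β⟩_g √det(g_{ij})` in the chart `φ_c`. -/
def l2Density (g : Metric n M) {k : ℕ} (α β : RawForm n M k) (c : M) (y : Coord n) : ℂ :=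
  ((chartPartition n M c ((extChartAt (𝓡 n) c).symm y) * √(gram g c y).det : ℝ) : ℂ) *
    formInner (gram g c y) (chartRep c α y) (chartRep c β y)

/-- The `L²` Hermitian product `∫_M ⟨α, β⟩_g dvol_g`, where the integral against the Riemannian
volume is computed in charts by means of a partition of unity. -/
def l2Inner (g : Metric n M) {k : ℕ} (α β : SmoothForm n M k) : ℂ :=
  ∑ᶠ c : M, ∫ y in (extChartAt (𝓡 n) c).target, l2Density g α.1 β.1 c y

lemma integrableOn_l2Density (g : Metric n M) {k : ℕ} (α β : SmoothForm n M k) (c : M) :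
    MeasureTheory.IntegrableOn (l2Density g α.1 β.1 c) (extChartAt (𝓡 n) c).target := by
  set K := extChartAt (𝓡 n) c '' tsupport (chartPartition n M c) with hK
  have hcont : ContinuousOn (l2Density g α.1 β.1 c) (extChartAt (𝓡 n) c).target := by
    refine ContinuousOn.mul (Complex.continuous_ofReal.comp_continuousOn (ContinuousOn.mul ?_ ?_))
      (continuousOn_formInner (continuousOn_gram g c)
        (fun y hy => (gram_pos g c hy).det_pos.ne') (α.2 c).continuousOn (β.2 c).continuousOn)
    · exact (chartPartition n M c).contMDiff.continuous.comp_continuousOn (continuousOn_extChartAt_symm c)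
    · exact Real.continuous_sqrt.comp_continuousOn
        ((continuous_id.matrix_det).comp_continuousOn (continuousOn_gram g c))
  have hcomp : IsCompact K :=
    (isClosed_tsupport _).isCompact.image_of_continuousOn
      ((continuousOn_extChartAt c).mono (chartPartition_sub c))
  have hsub : K ⊆ (extChartAt (𝓡 n) c).target := by
    rintro _ ⟨x, hx, rfl⟩
    exact (extChartAt (𝓡 n) c).map_source (chartPartition_sub c hx)
  refine MeasureTheory.IntegrableOn.of_forall_sdiff_eq_zero
    ((hcont.mono hsub).integrableOn_compact hcomp)
    (isOpen_extChartAt_target (I := 𝓡 n) c).measurableSet ?_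
  rintro y ⟨hy, hyK⟩
  have h0 : chartPartition n M c ((extChartAt (𝓡 n) c).symm y) = 0 := by
    by_contra h
    exact hyK ⟨_, subset_tsupport _ h, (extChartAt (𝓡 n) c).right_inv hy⟩
  rw [l2Density, h0]
  simp

lemma finite_support_l2 (g : Metric n M) {k : ℕ} (α β : SmoothForm n M k) :
    (Function.support fun c : M =>
      ∫ y in (extChartAt (𝓡 n) c).target, l2Density g α.1 β.1 c y).Finite := by
  refine ((chartPartition n M).locallyFinite.finite_nonempty_of_compact).subset ?_
  intro c hc
  by_contra h
  apply hc
  have h0 : ∀ x, chartPartition n M c x = 0 := by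
    intro x
    by_contra hx
    exact h ⟨x, hx⟩
  simp [l2Density, h0]

lemma l2Inner_add_right (g : Metric n M) {k : ℕ} (α β β' : SmoothForm n M k) :
    l2Inner g α (β + β') = l2Inner g α β + l2Inner g α β' := by
  unfold l2Inner
  rw [← finsum_add_distrib (finite_support_l2 g α β) (finite_support_l2 g α β')]
  refine finsum_congr fun c => ?_
  rw [← MeasureTheory.integral_add (integrableOn_l2Density g α β c)
    (integrableOn_l2Density g α β' c)]
  refine MeasureTheory.integral_congr_ae (Filter.Eventually.of_forall fun y => ?_)
  simp only [l2Density, Submodule.coe_add, chartRep_add, formInner, Pi.add_apply,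
    ContinuousAlternatingMap.add_apply, map_add, mul_add, Finset.sum_add_distrib]

lemma l2Inner_smul_right (g : Metric n M) {k : ℕ} (z : ℂ) (α β : SmoothForm n M k) :
    l2Inner g α (z • β) = (starRingEnd ℂ) z * l2Inner g α β := by
  unfold l2Inner
  rw [mul_finsum]
  refine finsum_congr fun c => ?_
  rw [← MeasureTheory.integral_const_mul]
  refine MeasureTheory.integral_congr_ae (Filter.Eventually.of_forall fun y => ?_)
  simp only [l2Density, Submodule.coe_smul, chartRep_smul, formInner, Pi.smul_apply,
    ContinuousAlternatingMap.smul_apply, map_mul, smul_eq_mul, Finset.mul_sum]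
  refine Finset.sum_congr rfl fun I _ => Finset.sum_congr rfl fun K _ => ?_
  ring

/-- `γ = P^* β`, where `P^*` is the formal `L²`-adjoint of the operator `P`: for every smooth
form `α`, `⟨Pα, β⟩ = ⟨α, γ⟩`. There is at most one such `γ`; for the differential operators
considered below integration by parts provides one for every `β`. -/
def IsAdjointValue (g : Metric n M) {k l : ℕ} (P : SmoothForm n M k →ₗ[ℂ] SmoothForm n M l)
    (β : SmoothForm n M l) (γ : SmoothForm n M k) : Prop :=
  ∀ α : SmoothForm n M k, l2Inner g (P α) β = l2Inner g α γ

lemma IsAdjointValue.zero (g : Metric n M) {k l : ℕ}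
    (P : SmoothForm n M k →ₗ[ℂ] SmoothForm n M l) : IsAdjointValue g P 0 0 := fun α => by
  rw [← zero_smul ℂ (0 : SmoothForm n M l), ← zero_smul ℂ (0 : SmoothForm n M k),
    l2Inner_smul_right, l2Inner_smul_right]
  simp

lemma IsAdjointValue.add {g : Metric n M} {k l : ℕ}
    {P : SmoothForm n M k →ₗ[ℂ] SmoothForm n M l} {β β' : SmoothForm n M l}
    {γ γ' : SmoothForm n M k} (h : IsAdjointValue g P β γ) (h' : IsAdjointValue g P β' γ') :
    IsAdjointValue g P (β + β') (γ + γ') := fun α => by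
  rw [l2Inner_add_right, l2Inner_add_right, h α, h' α]

lemma IsAdjointValue.smul {g : Metric n M} {k l : ℕ}
    {P : SmoothForm n M k →ₗ[ℂ] SmoothForm n M l} {β : SmoothForm n M l}
    {γ : SmoothForm n M k} (z : ℂ) (h : IsAdjointValue g P β γ) :
    IsAdjointValue g P (z • β) (z • γ) := fun α => by
  rw [l2Inner_smul_right, l2Inner_smul_right, h α]

/-- `η = Δ_{d+d^c} α` for `1`-forms `α`, `η`, where
`Δ_{d+d^c} = (dd^c)(dd^c)^* + (dd^c)^*(dd^c) + (d^*d^c)(d^*d^c)^* + (d^*d^c)^*(d^*d^c) + d^*d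
+ (d^c)^*d^c` and `(d^*d^c)^* = (d^c)^*d`. The first summand vanishes on `1`-forms, because
`(dd^c)^*` lowers the degree by two. -/
def IsLaplacianValue (J : AlmostComplexStructure n M) (g : Metric n M)
    (α η : SmoothForm n M 1) : Prop :=
  ∃ η₂ u η₃ v η₄ η₅ η₆ : SmoothForm n M 1,
    -- `η₂ = (dd^c)^* dd^c α`
    IsAdjointValue g (extD 2 ∘ₗ J.dc 1) (extD 2 (J.dc 1 α)) η₂ ∧
    -- `u = (d^*d^c)^* α = (d^c)^* d α` and `η₃ = d^* d^c u`
    IsAdjointValue g (J.dc 1) (extD 1 α) u ∧ IsAdjointValue g (extD 1) (J.dc 1 u) η₃ ∧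
    -- `v = d^* d^c α` and `η₄ = (d^*d^c)^* v = (d^c)^* d v`
    IsAdjointValue g (extD 1) (J.dc 1 α) v ∧ IsAdjointValue g (J.dc 1) (extD 1 v) η₄ ∧
    -- `η₅ = d^* d α`
    IsAdjointValue g (extD 1) (extD 1 α) η₅ ∧
    -- `η₆ = (d^c)^* d^c α`
    IsAdjointValue g (J.dc 1) (J.dc 1 α) η₆ ∧
    η = η₂ + η₃ + η₄ + η₅ + η₆

/-- The space `ℋ¹_{d+d^c} = A¹ ∩ ker Δ_{d+d^c}` of `(d+d^c)`-harmonic `1`-forms. -/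
def harmonicOne (J : AlmostComplexStructure n M) (g : Metric n M) :
    Submodule ℂ (SmoothForm n M 1) where
  carrier := {α | IsLaplacianValue J g α 0}
  zero_mem' := by
    refine ⟨0, 0, 0, 0, 0, 0, 0, ?_, ?_, ?_, ?_, ?_, ?_, ?_, by simp⟩ <;>
      simpa using IsAdjointValue.zero g _
  add_mem' := by
    rintro α α' ⟨a, b, c, d, e, p, q, ha, hb, hc, hd, he, hp, hq, h⟩
      ⟨a', b', c', d', e', p', q', ha', hb', hc', hd', he', hp', hq', h'⟩
    refine ⟨a + a', b + b', c + c', d + d', e + e', p + p', q + q', ?_, ?_, ?_, ?_, ?_, ?_, ?_, ?_⟩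
    · simpa using ha.add ha'
    · simpa using hb.add hb'
    · simpa using hc.add hc'
    · simpa using hd.add hd'
    · simpa using he.add he'
    · simpa using hp.add hp'
    · simpa using hq.add hq'
    · have := congrArg₂ (· + ·) h h'
      simp only [add_zero] at this
      rw [this]; abel
  smul_mem' := by
    rintro z α ⟨a, b, c, d, e, p, q, ha, hb, hc, hd, he, hp, hq, h⟩
    refine ⟨z • a, z • b, z • c, z • d, z • e, z • p, z • q, ?_, ?_, ?_, ?_, ?_, ?_, ?_, ?_⟩
    · simpa using ha.smul z
    · simpa using hb.smul z
    · simpa using hc.smul z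
    · simpa using hd.smul z
    · simpa using he.smul z
    · simpa using hp.smul z
    · simpa using hq.smul z
    · simp only [← smul_add, ← h, smul_zero]

/-- A `1`-form that is `d`-closed and `d^c`-closed is `(d+d^c)`-harmonic. -/
lemma mem_harmonicOne_of_closed (J : AlmostComplexStructure n M) (g : Metric n M)
    {α : SmoothForm n M 1} (h : extD 1 α = 0) (h' : J.dc 1 α = 0) : α ∈ harmonicOne J g := by
  refine ⟨0, 0, 0, 0, 0, 0, 0, ?_, ?_, ?_, ?_, ?_, ?_, ?_, by simp⟩ <;>
    simpa [h, h'] using IsAdjointValue.zero g _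

/-- The number `h¹_{d+d^c} = dim_ℂ ℋ¹_{d+d^c}`. -/
def hOne (J : AlmostComplexStructure n M) (g : Metric n M) : Cardinal :=
  Module.rank ℂ (harmonicOne J g)

end Integration

/-- The closed `1`-forms. -/
def closedOne (n : ℕ) (M : Type*) [TopologicalSpace M] [ChartedSpace (Coord n) M]
    [IsManifold (𝓡 n) ∞ M] : Submodule ℂ (SmoothForm n M 1) := LinearMap.ker (extD 1)

/-- The exact `1`-forms. -/
def exactOne (n : ℕ) (M : Type*) [TopologicalSpace M] [ChartedSpace (Coord n) M]
    [IsManifold (𝓡 n) ∞ M] : Submodule ℂ (SmoothForm n M 1) := LinearMap.range (extD 0)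

instance : AddCommGroup (closedOne n M) := Submodule.addCommGroup _

instance : Module ℂ (closedOne n M) := Submodule.module _

/-- The first complex de Rham cohomology group: closed `1`-forms modulo exact `1`-forms. -/
abbrev DeRhamOne (n : ℕ) (M : Type*) [TopologicalSpace M] [ChartedSpace (Coord n) M]
    [IsManifold (𝓡 n) ∞ M] : Type _ :=
  closedOne n M ⧸ (exactOne n M).submoduleOf (closedOne n M)

/-- The de Rham class `[α]` of a closed `1`-form. -/
def deRhamClass : closedOne n M →ₗ[ℂ] DeRhamOne n M := Submodule.mkQ _

/-- The first Betti number `b₁ = dim_ℂ H¹_dR(M; ℂ)`. -/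
def bettiOne (n : ℕ) (M : Type*) [TopologicalSpace M] [ChartedSpace (Coord n) M]
    [IsManifold (𝓡 n) ∞ M] : Cardinal :=
  Module.rank ℂ (DeRhamOne n M)

end Forms
end
end AlmostComplex

/-!
Pairing `Δ_{d+d^c} α = 0` with `α` expresses zero as a sum of squared `L²` norms, two of which are
those of `dα` and `d^c α`. Since the `L²` product is positive definite
(`eq_zero_of_l2Inner_self_re_eq_zero`), `ℋ¹_{d+d^c}` consists of the `1`-forms `α` with
`dα = 0` and `dJα = 0` (`mem_harmonicOne_iff`).

If such an `α` is exact, `α = df`, then `dJdf = 0`. In a chart, evaluating this `2`-form on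
`(v, Jv)` shows that every real component `u` of `f` satisfies, for every constant vector `v`, an
equation `D²u(v, v) + D²u(Jv, Jv) = Du(B v)` without zeroth-order term (`second_order_chartFun`).
Each of these operators is degenerate, but Hopf's proof of the strong maximum principle only needs
the one whose direction `v` is normal to the touching ball (`false_of_isolated_max_on_closedBall`).
So the set where `u` is maximal is open (`eventually_eq_of_le_of_eq`), `f` is constant on the
compact connected manifold, and `α = 0`. This gives the injection into de Rham cohomology and the
inequality.

Finally `ℋ¹_{d+d^c}` is stable under `J` and under complex conjugation, which commute. If it were a
line, `J` would act on it by a real scalar of square `-1`; hence its dimension is never one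
(`hOne_eq_zero_of_le_one`).
-/

/-! ### The strong maximum principle -/

namespace AlmostComplex

section MaximumPrinciple

lemma fderiv_fderiv_apply_nonpos_of_isLocalMax {E : Type*} [NormedAddCommGroup E]
    [NormedSpace ℝ E] {w : E → ℝ} {q : E} (hw : ContDiffAt ℝ 2 w q) (hmax : IsLocalMax w q)
    (u : E) : fderiv ℝ (fderiv ℝ w) q u u ≤ 0 := by
  by_contra! hpos
  have hline : ∀ s : ℝ, HasDerivAt (fun s : ℝ => q + s • u) u s := fun s => by
    simpa using ((hasDerivAt_id s).smul_const u).const_add q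
  have hq : q + (0 : ℝ) • u = q := by simp
  have htend : Filter.Tendsto (fun s : ℝ => q + s • u) (𝓝 0) (𝓝 q) := by
    simpa [hq] using (hline 0).continuousAt.tendsto
  set G : ℝ → ℝ := fun s => w (q + s • u) with hG
  have hdiff : ∀ᶠ y in 𝓝 q, DifferentiableAt ℝ w y :=
    (hw.eventually (by simp)).mono fun y hy => hy.differentiableAt (by simp)
  have hderiv : deriv G =ᶠ[𝓝 0] fun s => fderiv ℝ w (q + s • u) u :=
    (htend.eventually hdiff).mono fun s hs =>
      (hs.hasFDerivAt.comp_hasDerivAt s (hline s)).deriv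
  have hD : DifferentiableAt ℝ (fderiv ℝ w) q :=
    (hw.fderiv_right (m := 1) (by norm_num)).differentiableAt (by simp)
  have hsecond : deriv (deriv G) 0 = fderiv ℝ (fderiv ℝ w) q u u := by
    rw [hderiv.deriv_eq]
    have h1 : HasFDerivAt (fderiv ℝ w) (fderiv ℝ (fderiv ℝ w) q) (q + (0 : ℝ) • u) := by
      rw [hq]; exact hD.hasFDerivAt
    have h2 := h1.comp_hasDerivAt (0 : ℝ) (hline 0)
    exact (h2.clm_apply (hasDerivAt_const (0 : ℝ) u)).deriv.trans (by simp)
  have hmaxG : IsLocalMax G 0 := by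
    have := htend.eventually hmax
    simpa [IsLocalMax, IsMaxFilter, hG] using this
  have hcont : ContinuousAt G 0 := by
    have : ContinuousAt w (q + (0 : ℝ) • u) := by rw [hq]; exact hw.continuousAt
    exact ContinuousAt.comp (f := fun s : ℝ => q + s • u) this (hline 0).continuousAt
  have hminG := isLocalMin_of_deriv_deriv_pos (hsecond ▸ hpos) hmaxG.deriv_eq_zero hcont
  have hconst : G =ᶠ[𝓝 0] fun _ => G 0 := by
    filter_upwards [hmaxG, hminG] with s h1 h2 using le_antisymm h1 h2
  have : deriv (deriv G) 0 = 0 := by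
    rw [hconst.deriv.deriv_eq]; simp
  exact hpos.ne' (hsecond ▸ this)

variable {E : Type*} [NormedAddCommGroup E] [InnerProductSpace ℝ E]

/-- The function `t + λt²` with `t = ‖z - c‖² - ‖y - c‖²`, which on a neighbourhood of `z` is
positive inside the ball centred at `c` with `z` on its boundary, and negative outside. -/
def barrier (l : ℝ) (c z y : E) : ℝ :=
  (‖z - c‖ ^ 2 - ‖y - c‖ ^ 2) + l * (‖z - c‖ ^ 2 - ‖y - c‖ ^ 2) ^ 2

lemma contDiff_barrier (l : ℝ) (c z : E) : ContDiff ℝ 2 (barrier l c z) := by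
  have h : ContDiff ℝ 2 fun y : E => ‖y - c‖ ^ 2 :=
    (contDiff_id.sub contDiff_const).norm_sq ℝ
  exact (contDiff_const.sub h).add (contDiff_const.mul ((contDiff_const.sub h).pow 2))

lemma hasFDerivAt_const_sub_norm_sub_sq (a : ℝ) (c y : E) :
    HasFDerivAt (fun y : E => a - ‖y - c‖ ^ 2) (-(2 • innerSL ℝ (y - c))) y := by
  have := (((hasFDerivAt_id y).sub_const c).norm_sq).const_sub a
  simpa using this

lemma fderiv_barrier (l : ℝ) (c z : E) :
    fderiv ℝ (barrier l c z) = fun y =>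
      (-2 * (1 + 2 * l * (‖z - c‖ ^ 2 - ‖y - c‖ ^ 2))) • innerSL ℝ (y - c) := by
  funext y
  have h := hasFDerivAt_const_sub_norm_sub_sq (‖z - c‖ ^ 2) c y
  have h2 := h.add ((h.pow 2).const_mul l)
  refine HasFDerivAt.fderiv (h2.congr_fderiv ?_)
  ext u
  simp
  ring

lemma fderiv_fderiv_barrier (l : ℝ) (c z y u : E) :
    fderiv ℝ (fderiv ℝ (barrier l c z)) y u u =
      -2 * (1 + 2 * l * (‖z - c‖ ^ 2 - ‖y - c‖ ^ 2)) * ‖u‖ ^ 2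
        + 8 * l * (inner ℝ (y - c) u) ^ 2 := by
  rw [fderiv_barrier]
  have h := hasFDerivAt_const_sub_norm_sub_sq (‖z - c‖ ^ 2) c y
  have h1 := ((h.const_mul (2 * l)).const_add 1).const_mul (-2)
  have h2 : HasFDerivAt (fun y : E => innerSL ℝ (y - c)) (innerSL ℝ : E →L[ℝ] E →L[ℝ] ℝ) y :=
    (innerSL ℝ : E →L[ℝ] E →L[ℝ] ℝ).hasFDerivAt.comp y ((hasFDerivAt_id y).sub_const c)
  refine (congrArg (fun T : E →L[ℝ] E →L[ℝ] ℝ => T u u) (h1.smul h2).fderiv).trans ?_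
  have h3 : (innerSL ℝ : E →L[ℝ] E →L[ℝ] ℝ) u u = ‖u‖ ^ 2 := real_inner_self_eq_norm_sq u
  simp [h3, inner_sub_left]
  ring

/-- Hopf's boundary argument: a solution cannot attain its supremum at a point `z` on the boundary
of a ball whose closure contains no other point where the supremum is attained. The only direction
of the equation that enters is `v = z - c`, normal to the ball. -/
lemma false_of_isolated_max_on_closedBall [FiniteDimensional ℝ E] {Ω : Set E} (hΩ : IsOpen Ω)
    {f : E → ℝ} (hf : ContDiffOn ℝ 2 f Ω) {A B : E → E → E}
    (hA : ∀ v, ContinuousOn (fun y => A y v) Ω) (hB : ∀ v, ContinuousOn (fun y => B y v) Ω)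
    (hL : ∀ y ∈ Ω, ∀ v, fderiv ℝ (fderiv ℝ f) y v v + fderiv ℝ (fderiv ℝ f) y (A y v) (A y v) =
      fderiv ℝ f y (B y v))
    {C : ℝ} (hle : ∀ y ∈ Ω, f y ≤ C) {c z : E} (hz : z ∈ Ω) (hzC : f z = C) (hcz : z ≠ c)
    (huniq : ∀ y ∈ Ω, f y = C → ‖y - c‖ ≤ ‖z - c‖ → y = z) : False := by
  set v : E := z - c with hv
  have hv0 : 0 < ‖v‖ := norm_pos_iff.2 (sub_ne_zero.2 hcz)
  -- `l` is so large that the operator in the direction `v` is positive on the barrier at `z`.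
  obtain ⟨l, hl0, hl⟩ : ∃ l : ℝ, 0 < l ∧
      2 * (‖v‖ ^ 2 + ‖A z v‖ ^ 2) - 2 * inner ℝ v (B z v) < 8 * l * (‖v‖ ^ 2) ^ 2 := by
    set K := 2 * (‖v‖ ^ 2 + ‖A z v‖ ^ 2) - 2 * inner ℝ v (B z v)
    refine ⟨(|K| + 1) / (8 * (‖v‖ ^ 2) ^ 2), by positivity, ?_⟩
    have : 8 * ((|K| + 1) / (8 * (‖v‖ ^ 2) ^ 2)) * (‖v‖ ^ 2) ^ 2 = |K| + 1 := by
      field_simp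
    rw [this]
    linarith [le_abs_self K]
  set h := barrier l c z with hh
  have hhc : ContDiff ℝ 2 h := contDiff_barrier l c z
  set P : E → ℝ := fun y => fderiv ℝ (fderiv ℝ h) y v v
    + fderiv ℝ (fderiv ℝ h) y (A y v) (A y v) - fderiv ℝ h y (B y v) with hP
  have hPcont : ContinuousAt P z := by
    have h1 := (hA v).continuousAt (hΩ.mem_nhds hz)
    have h2 := (hB v).continuousAt (hΩ.mem_nhds hz)
    simp only [hP, hh, fderiv_fderiv_barrier]
    simp only [fderiv_barrier, smul_apply, innerSL_apply_apply, smul_eq_mul]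
    fun_prop
  have hPz : 0 < P z := by
    simp only [hP, hh, fderiv_fderiv_barrier]
    simp only [fderiv_barrier, smul_apply, innerSL_apply_apply, smul_eq_mul,
      ← hv, real_inner_self_eq_norm_sq]
    have : 0 ≤ 8 * l * (inner ℝ v (A z v)) ^ 2 := by positivity
    linarith
  have hsign : ∀ᶠ y in 𝓝 z, 0 < 1 + l * (‖v‖ ^ 2 - ‖y - c‖ ^ 2) := by
    have : ContinuousAt (fun y => 1 + l * (‖v‖ ^ 2 - ‖y - c‖ ^ 2)) z := by fun_prop
    refine this.eventually_const_lt ?_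
    simp [← hv]
  obtain ⟨r, hr, hball⟩ := Metric.nhds_basis_closedBall.mem_iff.1
    ((hPcont.eventually_const_lt hPz).and (hsign.and (hΩ.mem_nhds hz)))
  have hU : Metric.closedBall z r ⊆ Ω := fun y hy => (hball hy).2.2
  have hfac : ∀ y, h y = (‖v‖ ^ 2 - ‖y - c‖ ^ 2) * (1 + l * (‖v‖ ^ 2 - ‖y - c‖ ^ 2)) := by
    intro y; simp only [hh, barrier, ← hv]; ring
  -- On the part of the sphere inside the ball around `c`, `f` stays away from its supremum.
  set S := Metric.sphere z r ∩ Metric.closedBall c ‖v‖ with hS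
  have hScomp : IsCompact S := (isCompact_sphere z r).inter_right Metric.isClosed_closedBall
  have hSΩ : S ⊆ Ω := fun y hy => hU (Metric.sphere_subset_closedBall hy.1)
  have hSlt : ∀ y ∈ S, f y < C := by
    intro y hy
    refine lt_of_le_of_ne (hle y (hSΩ hy)) fun heq => ?_
    have hyz := huniq y (hSΩ hy) heq (by simpa [dist_eq_norm] using hy.2)
    have h0 := hy.1
    rw [hyz] at h0
    simp at h0
    exact hr.ne' h0.symm
  obtain ⟨e, he0, he⟩ : ∃ e : ℝ, 0 < e ∧ ∀ y ∈ S, f y + e * h y < C := by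
    rcases S.eq_empty_or_nonempty with hem | hne
    · exact ⟨1, one_pos, by simp [hem]⟩
    obtain ⟨a, ha, hamax⟩ := hScomp.exists_isMaxOn hne (hf.continuousOn.mono hSΩ)
    obtain ⟨b, hb, hbmax⟩ := hScomp.exists_isMaxOn hne hhc.continuous.continuousOn
    have hpos : 0 < C - f a := sub_pos.2 (hSlt a ha)
    refine ⟨(C - f a) / (|h b| + 1), by positivity, fun y hy => ?_⟩
    have h1 : f y ≤ f a := hamax hy
    have h2 : h y ≤ |h b| := (hbmax hy).trans (le_abs_self _)
    have h3 : (C - f a) / (|h b| + 1) * h y ≤ (C - f a) / (|h b| + 1) * |h b| := by gcongr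
    have h4 : (C - f a) / (|h b| + 1) * |h b| < C - f a := by
      rw [div_mul_eq_mul_div, div_lt_iff₀ (by positivity)]
      nlinarith
    linarith
  set w : E → ℝ := fun y => f y + e * h y with hw
  have hwcont : ContinuousOn w (Metric.closedBall z r) :=
    (hf.continuousOn.mono hU).add (continuousOn_const.mul hhc.continuous.continuousOn)
  obtain ⟨q, hq, hqmax⟩ := (isCompact_closedBall z r).exists_isMaxOn
    ⟨z, Metric.mem_closedBall_self hr.le⟩ hwcont
  have hwz : w z = C := by simp [hw, hfac, hzC, ← hv]
  have hqC : C ≤ w q := hwz ▸ hqmax (Metric.mem_closedBall_self hr.le)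
  have hqball : q ∈ Metric.ball z r := by
    by_contra hnot
    have hqs : q ∈ Metric.sphere z r := by
      rw [Metric.mem_ball, not_lt] at hnot
      exact le_antisymm hq hnot
    by_cases hqc : q ∈ Metric.closedBall c ‖v‖
    · exact absurd (he q ⟨hqs, hqc⟩) (not_lt.2 hqC)
    · have hlt : ‖v‖ < ‖q - c‖ := by simpa [dist_eq_norm] using hqc
      have hneg : h q < 0 := by
        rw [hfac]
        refine mul_neg_of_neg_of_pos ?_ (hball hq).2.1
        nlinarith
      have := hle q (hU hq)
      have h5 : e * h q < 0 := mul_neg_of_pos_of_neg he0 hneg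
      simp only [hw] at hqC
      linarith
  have hqloc : IsLocalMax w q :=
    hqmax.isLocalMax (Filter.mem_of_superset (Metric.isOpen_ball.mem_nhds hqball)
      Metric.ball_subset_closedBall)
  have hqΩ := hU hq
  have hfq : ContDiffAt ℝ 2 f q := hf.contDiffAt (hΩ.mem_nhds hqΩ)
  have hhq : ContDiffAt ℝ 2 h q := hhc.contDiffAt
  have hwq : ContDiffAt ℝ 2 w q := hfq.add (contDiffAt_const.mul hhq)
  have hfd : fderiv ℝ w =ᶠ[𝓝 q] fun y => fderiv ℝ f y + e • fderiv ℝ h y := by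
    filter_upwards [hΩ.mem_nhds hqΩ] with y hy
    have h1 : DifferentiableAt ℝ f y :=
      (hf.contDiffAt (hΩ.mem_nhds hy)).differentiableAt (by simp)
    have h2 : DifferentiableAt ℝ h y := hhc.contDiffAt.differentiableAt (by simp)
    exact (h1.hasFDerivAt.add (h2.hasFDerivAt.const_mul e)).fderiv
  have hfdd : fderiv ℝ (fderiv ℝ w) q = fderiv ℝ (fderiv ℝ f) q + e • fderiv ℝ (fderiv ℝ h) q := by
    rw [hfd.fderiv_eq]
    have h1 : DifferentiableAt ℝ (fderiv ℝ f) q :=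
      (hfq.fderiv_right (m := 1) (by norm_num)).differentiableAt (by simp)
    have h2 : DifferentiableAt ℝ (fderiv ℝ h) q :=
      (hhq.fderiv_right (m := 1) (by norm_num)).differentiableAt (by simp)
    exact (h1.hasFDerivAt.add (h2.hasFDerivAt.const_smul e)).fderiv
  have h1 := fderiv_fderiv_apply_nonpos_of_isLocalMax hwq hqloc v
  have h2 := fderiv_fderiv_apply_nonpos_of_isLocalMax hwq hqloc (A q v)
  have h3 : fderiv ℝ w q (B q v) = 0 := by rw [hqloc.fderiv_eq_zero]; rfl
  rw [hfd.eq_of_nhds] at h3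
  rw [hfdd] at h1 h2
  simp only [add_apply, smul_apply, smul_eq_mul] at h1 h2 h3
  have h4 := hL q hqΩ v
  have h5 : 0 < e * P q := mul_pos he0 (hball hq).1
  simp only [hP] at h5
  linarith

/-- The strong maximum principle for a function annihilated by all the second-order operators
`D²(v, v) + D²(A v, A v) - D(B v)`: the set where the supremum is attained is open. -/
theorem eventually_eq_of_le_of_eq [FiniteDimensional ℝ E] {Ω : Set E} (hΩ : IsOpen Ω)
    {f : E → ℝ} (hf : ContDiffOn ℝ 2 f Ω) {A B : E → E → E}
    (hA : ∀ v, ContinuousOn (fun y => A y v) Ω) (hB : ∀ v, ContinuousOn (fun y => B y v) Ω)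
    (hL : ∀ y ∈ Ω, ∀ v, fderiv ℝ (fderiv ℝ f) y v v + fderiv ℝ (fderiv ℝ f) y (A y v) (A y v) =
      fderiv ℝ f y (B y v))
    {C : ℝ} (hle : ∀ y ∈ Ω, f y ≤ C) {p : E} (hp : p ∈ Ω) (hpC : f p = C) :
    ∀ᶠ y in 𝓝 p, f y = C := by
  obtain ⟨r, hr, hball⟩ := Metric.nhds_basis_closedBall.mem_iff.1 (hΩ.mem_nhds hp)
  filter_upwards [Metric.ball_mem_nhds p (half_pos hr)] with y hy
  by_contra hyC
  rw [Metric.mem_ball] at hy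
  set Z := Metric.closedBall p r ∩ f ⁻¹' {C} with hZ
  have hZcomp : IsCompact Z :=
    (isCompact_closedBall p r).of_isClosed_subset
      ((hf.continuousOn.mono hball).preimage_isClosed_of_isClosed Metric.isClosed_closedBall
        isClosed_singleton) inter_subset_left
  have hpZ : p ∈ Z := ⟨Metric.mem_closedBall_self hr.le, hpC⟩
  obtain ⟨z, hzZ, hzmin⟩ := hZcomp.exists_isMinOn ⟨p, hpZ⟩
    (f := fun x => dist x y) (by fun_prop)
  have hzp : dist z y ≤ dist y p := by rw [dist_comm y p]; exact hzmin hpZ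
  have hzy : z ≠ y := fun h => hyC (h ▸ hzZ.2)
  -- Halving the largest ball around `y` free of maxima leaves `z` as the only point of contact.
  set c := midpoint ℝ y z with hc
  have hcy : c - y = (1 / 2 : ℝ) • (z - y) := by
    rw [hc, midpoint_eq_smul_add, invOf_eq_inv]; module
  have hzc : z - c = (1 / 2 : ℝ) • (z - y) := by
    rw [hc, midpoint_eq_smul_add, invOf_eq_inv]; module
  have hnorm : ‖z - c‖ = 1 / 2 * dist z y := by
    rw [hzc, norm_smul, dist_eq_norm]; norm_num
  refine false_of_isolated_max_on_closedBall hΩ hf hA hB hL hle (hball hzZ.1) hzZ.2 (c := c)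
    ?_ ?_
  · intro h
    rw [← sub_eq_zero, hzc] at h
    simp [sub_eq_zero, hzy] at h
  · intro x hx hxC hxc
    have hxy1 : dist x y ≤ dist z y := by
      have : dist x y ≤ ‖x - c‖ + ‖c - y‖ := by
        rw [dist_eq_norm]; exact norm_sub_le_norm_sub_add_norm_sub x c y
      rw [hcy, ← hzc] at this
      linarith
    have hxZ : x ∈ Z := by
      refine ⟨?_, hxC⟩
      have := dist_triangle x y p
      rw [Metric.mem_closedBall]
      linarith
    have hxy2 : dist z y ≤ dist x y := hzmin hxZ
    have hpar := parallelogram_law_with_norm ℝ (x - c) (z - c)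
    have hsum : (x - c) + (z - c) = x - y := by rw [hzc, ← hcy]; abel
    have hdiff : (x - c) - (z - c) = x - z := by abel
    rw [hsum, hdiff, ← dist_eq_norm x y] at hpar
    have h0 : ‖x - z‖ = 0 := by
      have h1 := norm_nonneg (x - c)
      have h2 := norm_nonneg (x - z)
      have h3 : 0 ≤ dist z y := dist_nonneg
      nlinarith
    exact sub_eq_zero.1 (norm_eq_zero.1 h0)

end MaximumPrinciple

/-! ### Positivity of the `L²` product -/

section InnerProduct

variable {n : ℕ}

/-- The linear map sending `stdVec l` to the `l`-th row of `B`. -/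
noncomputable def rowMap (B : Matrix (Fin n) (Fin n) ℝ) : Coord n →L[ℝ] Coord n :=
  (Matrix.toEuclideanLin B.transpose).toContinuousLinearMap

lemma rowMap_stdVec (B : Matrix (Fin n) (Fin n) ℝ) (l i : Fin n) :
    rowMap B (stdVec l) i = B l i := by
  simp [rowMap, stdVec, Matrix.toLpLin_apply, Matrix.mulVec_single]

lemma rowMap_surjective {B : Matrix (Fin n) (Fin n) ℝ} (hB : IsUnit B) :
    Function.Surjective (rowMap B) := by
  intro w
  refine ⟨WithLp.toLp 2 ((B.transpose)⁻¹.mulVec w.ofLp), ?_⟩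
  have hu : IsUnit B.transpose.det := by
    rw [Matrix.det_transpose]; exact (Matrix.isUnit_iff_isUnit_det B).1 hB
  simp [rowMap, Matrix.toLpLin_apply, Matrix.mulVec_mulVec, Matrix.mul_nonsing_inv _ hu]

/-- In a factorization `G⁻¹ = Bᵀ B`, the rows of `B` form a `G`-orthonormal frame of
vectors, in which the inner product of forms is the standard one. -/
lemma formInner_eq_sum_rowMap {G B : Matrix (Fin n) (Fin n) ℝ} (h : G⁻¹ = B.transpose * B) {k : ℕ}
    (α β : Coord n [⋀^Fin k]→L[ℝ] ℂ) :
    formInner G α β = (k.factorial : ℂ)⁻¹ * ∑ L : Fin k → Fin n,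
      α (fun a => rowMap B (stdVec (L a))) *
        (starRingEnd ℂ) (β fun a => rowMap B (stdVec (L a))) := by
  have hG : ∀ I K : Fin k → Fin n, ∏ a, G⁻¹ (I a) (K a) =
      ∑ L : Fin k → Fin n, (∏ a, B (L a) (I a)) * ∏ a, B (L a) (K a) := by
    intro I K
    simp only [h, Matrix.mul_apply, Matrix.transpose_apply, ← Finset.prod_mul_distrib]
    exact Finset.prod_univ_sum _ _ |>.trans (by simp)
  rw [formInner]
  congr 1
  simp only [alt_expand α (fun a => rowMap B _), alt_expand β (fun a => rowMap B _),
    rowMap_stdVec, map_sum, Finset.sum_mul_sum, hG]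
  symm
  rw [Finset.sum_comm]
  refine Finset.sum_congr rfl fun I _ => ?_
  rw [Finset.sum_comm]
  refine Finset.sum_congr rfl fun K _ => ?_
  rw [Complex.ofReal_sum, Finset.sum_mul, Finset.sum_mul]
  refine Finset.sum_congr rfl fun L _ => ?_
  simp only [Complex.real_smul, map_mul, Complex.conj_ofReal, Complex.ofReal_mul]
  ring

open scoped MatrixOrder in
lemma exists_rowMap_factorization {G : Matrix (Fin n) (Fin n) ℝ} (hG : G.PosDef) :
    ∃ B : Matrix (Fin n) (Fin n) ℝ, IsUnit B ∧ G⁻¹ = B.transpose * B := by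
  obtain ⟨B, hB⟩ := CStarAlgebra.nonneg_iff_eq_star_mul_self.1 hG.inv.posSemidef.nonneg
  refine ⟨B, ?_, by simpa [Matrix.star_eq_conjTranspose] using hB⟩
  have h := hG.inv.isUnit
  rw [hB] at h
  exact isUnit_of_mul_isUnit_right h

lemma formInner_conj_symm {G : Matrix (Fin n) (Fin n) ℝ} (hG : G.PosDef) {k : ℕ}
    (α β : Coord n [⋀^Fin k]→L[ℝ] ℂ) :
    formInner G β α = (starRingEnd ℂ) (formInner G α β) := by
  obtain ⟨B, -, hB⟩ := exists_rowMap_factorization hG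
  simp only [formInner_eq_sum_rowMap hB, map_mul, map_sum, map_inv₀, map_natCast,
    Complex.conj_conj]
  simp only [mul_comm]

lemma formInner_self_eq {G B : Matrix (Fin n) (Fin n) ℝ} (h : G⁻¹ = B.transpose * B) {k : ℕ}
    (α : Coord n [⋀^Fin k]→L[ℝ] ℂ) :
    formInner G α α = (((k.factorial : ℝ)⁻¹ * ∑ L : Fin k → Fin n,
      ‖α (fun a => rowMap B (stdVec (L a)))‖ ^ 2 : ℝ) : ℂ) := by
  rw [formInner_eq_sum_rowMap h]
  simp [Complex.mul_conj']

lemma formInner_self_re_nonneg {G : Matrix (Fin n) (Fin n) ℝ} (hG : G.PosDef) {k : ℕ}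
    (α : Coord n [⋀^Fin k]→L[ℝ] ℂ) : 0 ≤ (formInner G α α).re := by
  obtain ⟨B, -, hB⟩ := exists_rowMap_factorization hG
  rw [formInner_self_eq hB, Complex.ofReal_re]
  positivity

lemma eq_zero_of_formInner_self_re_eq_zero {G : Matrix (Fin n) (Fin n) ℝ} (hG : G.PosDef) {k : ℕ}
    {α : Coord n [⋀^Fin k]→L[ℝ] ℂ} (h : (formInner G α α).re = 0) : α = 0 := by
  obtain ⟨B, hBu, hB⟩ := exists_rowMap_factorization hG
  rw [formInner_self_eq hB, Complex.ofReal_re, mul_eq_zero, inv_eq_zero,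
    or_iff_right (by positivity), Finset.sum_eq_zero_iff_of_nonneg fun _ _ => by positivity] at h
  have hcomp : α.compContinuousLinearMap (rowMap B) = 0 := by
    ext w
    rw [alt_expand]
    refine Finset.sum_eq_zero fun L _ => ?_
    have hL : α (fun a => rowMap B (stdVec (L a))) = 0 := by
      simpa using h L (Finset.mem_univ L)
    exact (congrArg _ hL).trans (smul_zero _)
  ext w
  choose u hu using fun a => rowMap_surjective hBu (w a)
  have hw : w = fun a => rowMap B (u a) := funext fun a => (hu a).symm
  rw [hw]
  exact DFunLike.congr_fun hcomp u

end InnerProduct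

section L2

variable {n : ℕ} {M : Type*} [TopologicalSpace M] [ChartedSpace (Coord n) M]
  [IsManifold (𝓡 n) ∞ M]

/-- The differential of a chart is invertible, so a form vanishes at a point as soon as its
expression in one chart does. -/
lemma apply_eq_zero_of_chartRep_eq_zero {k : ℕ} {α : RawForm n M k} {c x : M}
    (hx : x ∈ (extChartAt (𝓡 n) c).source) (h : chartRep c α (extChartAt (𝓡 n) c x) = 0) :
    α x = 0 := by
  rw [chartRep_eq c α ((extChartAt (𝓡 n) c).left_inv hx)] at h
  have hid := mfderiv_symm_comp_mfderiv c hx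
  ext v
  refine Eq.trans ?_ (DFunLike.congr_fun h
    fun i => mfderiv (𝓡 n) 𝓘(ℝ, Coord n) (extChartAt (𝓡 n) c) x (v i))
  exact congrArg (α x) (funext fun i => (DFunLike.congr_fun hid (v i)).symm)

variable [T2Space M] [CompactSpace M]

lemma continuousOn_l2Density (g : Metric n M) {k : ℕ} (α β : SmoothForm n M k) (c : M) :
    ContinuousOn (l2Density g α.1 β.1 c) (extChartAt (𝓡 n) c).target := by
  refine ContinuousOn.mul (Complex.continuous_ofReal.comp_continuousOn (ContinuousOn.mul ?_ ?_))
    (continuousOn_formInner (continuousOn_gram g c)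
      (fun y hy => (gram_pos g c hy).det_pos.ne') (α.2 c).continuousOn (β.2 c).continuousOn)
  · exact (chartPartition n M c).contMDiff.continuous.comp_continuousOn
      (continuousOn_extChartAt_symm c)
  · exact Real.continuous_sqrt.comp_continuousOn
      ((continuous_id.matrix_det).comp_continuousOn (continuousOn_gram g c))

lemma l2Inner_conj_symm (g : Metric n M) {k : ℕ} (α β : SmoothForm n M k) :
    l2Inner g β α = (starRingEnd ℂ) (l2Inner g α β) := by
  unfold l2Inner
  refine Eq.trans (finsum_congr fun c => ?_)
    ((starRingEnd ℂ).toAddMonoidHom.map_finsum (finite_support_l2 g α β)).symm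
  refine Eq.trans ?_ integral_conj
  refine MeasureTheory.setIntegral_congr_fun
    (isOpen_extChartAt_target (I := 𝓡 n) c).measurableSet fun y hy => ?_
  simp only [l2Density, map_mul, Complex.conj_ofReal]
  rw [formInner_conj_symm (gram_pos g c hy)]

lemma l2Density_self_re (g : Metric n M) {k : ℕ} (α : RawForm n M k) (c : M) (y : Coord n) :
    (l2Density g α α c y).re =
      chartPartition n M c ((extChartAt (𝓡 n) c).symm y) * √(gram g c y).det *
        (formInner (gram g c y) (chartRep c α y) (chartRep c α y)).re := by
  rw [l2Density, Complex.re_ofReal_mul]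

lemma l2Density_self_re_nonneg (g : Metric n M) {k : ℕ} (α : RawForm n M k) (c : M)
    {y : Coord n} (hy : y ∈ (extChartAt (𝓡 n) c).target) : 0 ≤ (l2Density g α α c y).re := by
  rw [l2Density_self_re]
  exact mul_nonneg (mul_nonneg ((chartPartition n M).nonneg c _) (Real.sqrt_nonneg _))
    (formInner_self_re_nonneg (gram_pos g c hy) _)

lemma l2Inner_self_re (g : Metric n M) {k : ℕ} (α : SmoothForm n M k) :
    (l2Inner g α α).re =
      ∑ᶠ c : M, ∫ y in (extChartAt (𝓡 n) c).target, (l2Density g α.1 α.1 c y).re := by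
  unfold l2Inner
  refine (Complex.reAddGroupHom.map_finsum (finite_support_l2 g α α)).trans
    (finsum_congr fun c => ?_)
  exact (integral_re (integrableOn_l2Density g α α c)).symm

lemma setIntegral_l2Density_self_re_nonneg (g : Metric n M) {k : ℕ} (α : RawForm n M k) (c : M) :
    0 ≤ ∫ y in (extChartAt (𝓡 n) c).target, (l2Density g α α c y).re :=
  MeasureTheory.setIntegral_nonneg (isOpen_extChartAt_target (I := 𝓡 n) c).measurableSet
    fun _ hy => l2Density_self_re_nonneg g α c hy

lemma l2Inner_self_re_nonneg (g : Metric n M) {k : ℕ} (α : SmoothForm n M k) :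
    0 ≤ (l2Inner g α α).re := by
  rw [l2Inner_self_re]
  exact finsum_nonneg fun c => setIntegral_l2Density_self_re_nonneg g α.1 c

lemma eq_zero_of_l2Inner_self_re_eq_zero (g : Metric n M) {k : ℕ} {α : SmoothForm n M k}
    (h : (l2Inner g α α).re = 0) : α = 0 := by
  have hfin : (Function.support fun c : M => ∫ y in (extChartAt (𝓡 n) c).target,
      (l2Density g α.1 α.1 c y).re).Finite := by
    refine (finite_support_l2 g α α).subset fun c hc hc' => hc ?_
    rw [← Complex.zero_re, ← hc']
    exact integral_re (integrableOn_l2Density g α α c)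
  rw [l2Inner_self_re, finsum_eq_sum _ hfin,
    Finset.sum_eq_zero_iff_of_nonneg fun c _ => setIntegral_l2Density_self_re_nonneg g α.1 c] at h
  have hint : ∀ c : M, ∫ y in (extChartAt (𝓡 n) c).target, (l2Density g α.1 α.1 c y).re = 0 := by
    intro c
    by_contra hc
    exact hc (h c (hfin.mem_toFinset.2 hc))
  have hdens : ∀ c : M, ∀ y ∈ (extChartAt (𝓡 n) c).target, (l2Density g α.1 α.1 c y).re = 0 := by
    intro c
    have hopen := isOpen_extChartAt_target (I := 𝓡 n) c
    have hae := (MeasureTheory.setIntegral_eq_zero_iff_of_nonneg_ae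
      (MeasureTheory.ae_restrict_of_forall_mem hopen.measurableSet
        fun y hy => l2Density_self_re_nonneg g α.1 c hy)
      (integrableOn_l2Density g α α c).re).1 (hint c)
    exact MeasureTheory.Measure.eqOn_open_of_ae_eq hae hopen
      (Complex.continuous_re.comp_continuousOn (continuousOn_l2Density g α α c))
      continuousOn_const
  ext1
  funext x
  obtain ⟨c, hc⟩ := (chartPartition n M).exists_pos_of_mem (mem_univ x)
  have hx : x ∈ (extChartAt (𝓡 n) c).source :=
    chartPartition_sub c (subset_tsupport _ hc.ne')
  have hy := (extChartAt (𝓡 n) c).map_source hx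
  have h1 := hdens c _ hy
  rw [l2Density_self_re, (extChartAt (𝓡 n) c).left_inv hx] at h1
  exact apply_eq_zero_of_chartRep_eq_zero hx
    (eq_zero_of_formInner_self_re_eq_zero (gram_pos g c hy)
      ((mul_eq_zero.1 h1).resolve_left
        (mul_pos hc (Real.sqrt_pos.2 (gram_pos g c hy).det_pos)).ne'))

/-- Pairing `Δ_{d+d^c} α = 0` with `α` makes a sum of squared `L²` norms vanish, among them those
of `dα` and `d^c α`. -/
lemma closed_of_mem_harmonicOne {J : AlmostComplexStructure n M} {g : Metric n M}
    {α : SmoothForm n M 1} (h : α ∈ harmonicOne J g) : extD 1 α = 0 ∧ J.dc 1 α = 0 := by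
  obtain ⟨η₂, u, η₃, v, η₄, η₅, η₆, h2, hu, h3, hv, h4, h5, h6, hsum⟩ := h
  have e2 := h2 α
  have e3 := (h3 α).symm.trans ((l2Inner_conj_symm g _ _).trans (congrArg _ (hu u)))
  have e4 := (h4 α).symm.trans ((l2Inner_conj_symm g _ _).trans (congrArg _ (hv v)))
  have e5 := h5 α
  have e6 := h6 α
  have e0 : l2Inner g α (η₂ + η₃ + η₄ + η₅ + η₆) = 0 := by
    rw [← hsum, ← zero_smul ℂ (0 : SmoothForm n M 1), l2Inner_smul_right]
    simp
  simp only [l2Inner_add_right, e3, e4, ← e5, ← e6, ← e2] at e0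
  have hre := congrArg Complex.re e0
  simp only [Complex.add_re, Complex.conj_re, Complex.zero_re, LinearMap.comp_apply] at hre
  have p2 := l2Inner_self_re_nonneg g (extD 2 (J.dc 1 α))
  have p3 := l2Inner_self_re_nonneg g u
  have p4 := l2Inner_self_re_nonneg g v
  have p5 := l2Inner_self_re_nonneg g (extD 1 α)
  have p6 := l2Inner_self_re_nonneg g (J.dc 1 α)
  exact ⟨eq_zero_of_l2Inner_self_re_eq_zero g (by linarith),
    eq_zero_of_l2Inner_self_re_eq_zero g (by linarith)⟩

end L2

/-! ### Functions with `dJdf = 0` -/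

section DegenerateOperators

/-- If `du ∘ J` is closed at `y`, evaluating its differential on `(v, Jv)` gives a second-order
equation for `u` whose principal part is the Hessian on `v` and `Jv`. -/
lemma second_order_of_closed {E : Type*} [NormedAddCommGroup E] [NormedSpace ℝ E]
    {u : E → ℝ} {J : E → E →L[ℝ] E} {y : E} (hu : ContDiffAt ℝ 2 u y)
    (hJ : DifferentiableAt ℝ J y) (hJ2 : ∀ v, J y (J y v) = -v)
    (hsym : ∀ v w, fderiv ℝ (fun x => fderiv ℝ u x (J x w)) y v =
      fderiv ℝ (fun x => fderiv ℝ u x (J x v)) y w) (v : E) :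
    fderiv ℝ (fderiv ℝ u) y v v + fderiv ℝ (fderiv ℝ u) y (J y v) (J y v) =
      fderiv ℝ u y (fderiv ℝ J y v (J y v) - fderiv ℝ J y (J y v) v) := by
  have hD : DifferentiableAt ℝ (fderiv ℝ u) y :=
    (hu.fderiv_right (m := 1) (by norm_num)).differentiableAt (by simp)
  have key : ∀ v w, fderiv ℝ (fun x => fderiv ℝ u x (J x w)) y v =
      fderiv ℝ u y (fderiv ℝ J y v w) + fderiv ℝ (fderiv ℝ u) y v (J y w) := by
    intro v w
    have h1 := hJ.hasFDerivAt.clm_apply (hasFDerivAt_const w y)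
    rw [(hD.hasFDerivAt.clm_apply h1).fderiv]
    simp
  have h := hsym v (J y v)
  rw [key, key, hJ2, map_neg] at h
  rw [map_sub]
  linarith

end DegenerateOperators

section PointwiseOperations

variable {n : ℕ} {M : Type*} [TopologicalSpace M] [ChartedSpace (Coord n) M]

/-- The function underlying a `0`-form in a chart. -/
noncomputable def chartFun (c : M) (f : RawForm n M 0) (y : Coord n) : ℂ := chartRep c f y 0

lemma contDiffOn_chartFun (c : M) (f : SmoothForm n M 0) :
    ContDiffOn ℝ ∞ (chartFun c f.1) (extChartAt (𝓡 n) c).target :=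
  (ContinuousAlternatingMap.apply ℝ (Coord n) ℂ (0 : Fin 0 → Coord n)).contDiff.comp_contDiffOn
    (f.2 c)

lemma chartFun_extChartAt (c : M) (f : RawForm n M 0) {x : M}
    (hx : x ∈ (extChartAt (𝓡 n) c).source) : chartFun c f (extChartAt (𝓡 n) c x) = f x 0 := by
  rw [chartFun, chartRep_eq c f ((extChartAt (𝓡 n) c).left_inv hx)]
  exact congrArg (f x) (Subsingleton.elim _ _)

lemma chartFun_eq (c : M) (f : RawForm n M 0) (y : Coord n) :
    chartFun c f y = f ((extChartAt (𝓡 n) c).symm y) 0 :=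
  congrArg (f _) (Subsingleton.elim _ _)

lemma continuous_of_smoothForm_zero (f : SmoothForm n M 0) : Continuous fun x => f.1 x 0 := by
  refine continuous_iff_continuousAt.2 fun x => ?_
  have h1 : ContinuousAt (chartFun x f.1 ∘ extChartAt (𝓡 n) x) x :=
    ContinuousAt.comp ((contDiffOn_chartFun x f).continuousOn.continuousAt
      ((isOpen_extChartAt_target (I := 𝓡 n) x).mem_nhds (mem_extChartAt_target (I := 𝓡 n) x)))
      (continuousAt_extChartAt x)
  refine h1.congr ?_
  filter_upwards [(isOpen_extChartAt_source (I := 𝓡 n) x).mem_nhds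
    (mem_extChartAt_source (I := 𝓡 n) x)] with z hz
  exact chartFun_extChartAt x f.1 hz

/-- Complex conjugation of forms. -/
noncomputable def conjForm {k : ℕ} (α : SmoothForm n M k) : SmoothForm n M k :=
  ⟨fun x => (Complex.conjCLE : ℂ →L[ℝ] ℂ).compContinuousAlternatingMap (α.1 x), fun c =>
    contDiffOn_alt_of_apply fun v => (Complex.conjCLE : ℂ →L[ℝ] ℂ).contDiff.comp_contDiffOn
      ((ContinuousAlternatingMap.apply ℝ (Coord n) ℂ v).contDiff.comp_contDiffOn (α.2 c))⟩

lemma conjForm_smul {k : ℕ} (z : ℂ) (α : SmoothForm n M k) :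
    conjForm (z • α) = (starRingEnd ℂ) z • conjForm α := by
  ext x v
  exact map_mul (starRingEnd ℂ) z (α.1 x v)

end PointwiseOperations

section Charts

variable {n : ℕ} {M : Type*} [TopologicalSpace M] [ChartedSpace (Coord n) M]
  [IsManifold (𝓡 n) ∞ M]

namespace AlmostComplexStructure

variable (J : AlmostComplexStructure n M)

lemma chartFrame_inChart (c : M) {y : Coord n} (hy : y ∈ (extChartAt (𝓡 n) c).target)
    (v : Coord n) :
    chartFrame c y (J.inChart c y v) =
      J.toFun ((extChartAt (𝓡 n) c).symm y) (chartFrame c y v) := by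
  have hid := mfderiv_symm_comp_mfderiv c ((extChartAt (𝓡 n) c).map_target hy)
  rw [(extChartAt (𝓡 n) c).right_inv hy] at hid
  exact DFunLike.congr_fun hid (J.toFun ((extChartAt (𝓡 n) c).symm y) (chartFrame c y v))

lemma chartRep_rawAct (c : M) {k : ℕ} (α : RawForm n M k) {y : Coord n}
    (hy : y ∈ (extChartAt (𝓡 n) c).target) :
    chartRep c (J.rawAct α) y = (chartRep c α y).compContinuousLinearMap (J.inChart c y) := by
  ext v
  exact congrArg (α ((extChartAt (𝓡 n) c).symm y))
    (funext fun i => (J.chartFrame_inChart c hy (v i)).symm)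

lemma inChart_inChart (c : M) {y : Coord n} (hy : y ∈ (extChartAt (𝓡 n) c).target)
    (v : Coord n) : J.inChart c y (J.inChart c y v) = -v := by
  rw [← mfderiv_comp_chartFrame c hy (J.inChart c y (J.inChart c y v)),
    chartFrame_inChart J c hy, chartFrame_inChart J c hy, J.sq_eq_neg, map_neg,
    mfderiv_comp_chartFrame c hy]
  rfl

lemma contDiffOn_inChart_clm (c : M) :
    ContDiffOn ℝ ∞ (J.inChart c) (extChartAt (𝓡 n) c).target :=
  contDiffOn_clm_apply.2 (J.contDiffOn_inChart c)

end AlmostComplexStructure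

lemma chartRep_extD_zero_apply (c : M) (f : SmoothForm n M 0) {y : Coord n}
    (hy : y ∈ (extChartAt (𝓡 n) c).target) (v : Fin 1 → Coord n) :
    chartRep c (extD 0 f).1 y v = fderiv ℝ (chartFun c f.1) y (v 0) := by
  have hd : DifferentiableAt ℝ (chartRep c f.1) y :=
    ((f.2 c).contDiffAt ((isOpen_extChartAt_target (I := 𝓡 n) c).mem_nhds hy)).differentiableAt
      (by simp)
  refine (DFunLike.congr_fun (chartRep_rawExtDeriv f.2 c hy) v).trans ?_
  rw [extDeriv_apply hd]
  refine (Fin.sum_univ_one _).trans ?_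
  simp only [Fin.val_zero, pow_zero, one_smul]
  congr 1
  congr 1
  funext z
  exact congrArg (chartRep c f.1 z) (Subsingleton.elim _ _)

lemma fderiv_symm_of_closed {f : SmoothForm n M 0} {J : AlmostComplexStructure n M}
    (h : extD 1 (J.act 1 (extD 0 f)) = 0) (c : M) {y : Coord n}
    (hy : y ∈ (extChartAt (𝓡 n) c).target) (v w : Coord n) :
    fderiv ℝ (fun x => fderiv ℝ (chartFun c f.1) x (J.inChart c x w)) y v =
      fderiv ℝ (fun x => fderiv ℝ (chartFun c f.1) x (J.inChart c x v)) y w := by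
  set β := J.act 1 (extD 0 f) with hβ
  have hopen := isOpen_extChartAt_target (I := 𝓡 n) c
  have hd : DifferentiableAt ℝ (chartRep c β.1) y :=
    ((β.2 c).contDiffAt (hopen.mem_nhds hy)).differentiableAt (by simp)
  have hval : ∀ u : Fin 1 → Coord n, (fun x => chartRep c β.1 x u) =ᶠ[𝓝 y]
      fun x => fderiv ℝ (chartFun c f.1) x (J.inChart c x (u 0)) := by
    intro u
    filter_upwards [hopen.mem_nhds hy] with x hx
    exact (DFunLike.congr_fun (J.chartRep_rawAct c (extD 0 f).1 hx) u).trans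
      (chartRep_extD_zero_apply c f hx _)
  have h0 : extDeriv (chartRep c β.1) y ![v, w] = 0 := by
    rw [← chartRep_rawExtDeriv β.2 c hy, show rawExtDeriv β.1 = 0 from congrArg Subtype.val h,
      chartRep_zero]
    rfl
  rw [extDeriv_apply hd, Fin.sum_univ_two, (hval _).fderiv_eq, (hval _).fderiv_eq] at h0
  simpa [Fin.removeNth, add_neg_eq_zero] using h0

/-- A real component `u = ℓ ∘ f` of a function with `dJdf = 0` solves in each chart the
equations to which the strong maximum principle applies. -/
lemma second_order_chartFun {f : SmoothForm n M 0} {J : AlmostComplexStructure n M}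
    (h : extD 1 (J.act 1 (extD 0 f)) = 0) (ℓ : ℂ →L[ℝ] ℝ) (c : M) {y : Coord n}
    (hy : y ∈ (extChartAt (𝓡 n) c).target) (v : Coord n) :
    fderiv ℝ (fderiv ℝ fun z => ℓ (chartFun c f.1 z)) y v v +
      fderiv ℝ (fderiv ℝ fun z => ℓ (chartFun c f.1 z)) y (J.inChart c y v) (J.inChart c y v) =
      fderiv ℝ (fun z => ℓ (chartFun c f.1 z)) y
        (fderiv ℝ (J.inChart c) y v (J.inChart c y v) -
          fderiv ℝ (J.inChart c) y (J.inChart c y v) v) := by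
  have hopen := isOpen_extChartAt_target (I := 𝓡 n) c
  have hF := contDiffOn_chartFun c f
  have hJ : ContDiffAt ℝ ∞ (J.inChart c) y :=
    (J.contDiffOn_inChart_clm c).contDiffAt (hopen.mem_nhds hy)
  have hu : ContDiffOn ℝ ∞ (fun z => ℓ (chartFun c f.1 z)) (extChartAt (𝓡 n) c).target :=
    ℓ.contDiff.comp_contDiffOn hF
  refine second_order_of_closed
    ((hu.contDiffAt (hopen.mem_nhds hy)).of_le ENat.LEInfty.out)
    (hJ.differentiableAt (by simp)) (J.inChart_inChart c hy) (fun v w => ?_) v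
  have key : ∀ v w, fderiv ℝ (fun x => fderiv ℝ (fun z => ℓ (chartFun c f.1 z)) x
      (J.inChart c x w)) y v =
      ℓ (fderiv ℝ (fun x => fderiv ℝ (chartFun c f.1) x (J.inChart c x w)) y v) := by
    intro v w
    have hev : (fun x => fderiv ℝ (fun z => ℓ (chartFun c f.1 z)) x (J.inChart c x w)) =ᶠ[𝓝 y]
        fun x => ℓ (fderiv ℝ (chartFun c f.1) x (J.inChart c x w)) := by
      filter_upwards [hopen.mem_nhds hy] with x hx
      have hd : DifferentiableAt ℝ (chartFun c f.1) x :=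
        (hF.contDiffAt (hopen.mem_nhds hx)).differentiableAt (by simp)
      exact DFunLike.congr_fun (ℓ.hasFDerivAt.comp x hd.hasFDerivAt).fderiv _
    rw [hev.fderiv_eq]
    have hD : DifferentiableAt ℝ (fderiv ℝ (chartFun c f.1)) y :=
      (((hF.contDiffAt (hopen.mem_nhds hy)).of_le (m := 2) ENat.LEInfty.out).fderiv_right
        (m := 1) (by norm_num)).differentiableAt (by simp)
    have hd : DifferentiableAt ℝ (fun x => fderiv ℝ (chartFun c f.1) x (J.inChart c x w)) y :=
      hD.clm_apply ((hJ.differentiableAt (by simp)).clm_apply (differentiableAt_const w))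
    exact DFunLike.congr_fun (ℓ.hasFDerivAt.comp y hd.hasFDerivAt).fderiv v
  rw [key, key, fderiv_symm_of_closed h c hy]

/-- On a compact connected almost complex manifold a function with `dJdf = 0` is constant: by the
strong maximum principle, the set where a real component is maximal is open and closed. -/
lemma exists_const_of_closed [CompactSpace M] [ConnectedSpace M] {f : SmoothForm n M 0}
    {J : AlmostComplexStructure n M} (h : extD 1 (J.act 1 (extD 0 f)) = 0) (ℓ : ℂ →L[ℝ] ℝ) :
    ∃ C, ∀ x, ℓ (f.1 x 0) = C := by
  have hcont : Continuous fun x => ℓ (f.1 x 0) :=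
    ℓ.continuous.comp (continuous_of_smoothForm_zero f)
  obtain ⟨p, -, hp⟩ := isCompact_univ.exists_isMaxOn univ_nonempty hcont.continuousOn
  refine ⟨ℓ (f.1 p 0), ?_⟩
  have hclopen : IsClopen {x | ℓ (f.1 x 0) = ℓ (f.1 p 0)} := by
    refine ⟨isClosed_eq hcont continuous_const, isOpen_iff_mem_nhds.2 fun x hx => ?_⟩
    have hopen := isOpen_extChartAt_target (I := 𝓡 n) x
    have hxs := mem_extChartAt_source (I := 𝓡 n) x
    have hJ := J.contDiffOn_inChart_clm x
    have hJd : ContinuousOn (fderiv ℝ (J.inChart x)) (extChartAt (𝓡 n) x).target :=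
      hJ.continuousOn_fderiv_of_isOpen hopen (by simp)
    have hev := eventually_eq_of_le_of_eq hopen
      (f := fun z => ℓ (chartFun x f.1 z))
      ((ℓ.contDiff.comp_contDiffOn (contDiffOn_chartFun x f)).of_le ENat.LEInfty.out)
      (A := fun y v => J.inChart x y v)
      (B := fun y v => fderiv ℝ (J.inChart x) y v (J.inChart x y v) -
        fderiv ℝ (J.inChart x) y (J.inChart x y v) v)
      (fun v => hJ.continuousOn.clm_apply continuousOn_const)
      (fun v => ((hJd.clm_apply continuousOn_const).clm_apply
          (hJ.continuousOn.clm_apply continuousOn_const)).sub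
        ((hJd.clm_apply (hJ.continuousOn.clm_apply continuousOn_const)).clm_apply
          continuousOn_const))
      (fun y hy v => second_order_chartFun h ℓ x hy v)
      (C := ℓ (f.1 p 0))
      (fun y _ => by rw [chartFun_eq]; exact hp (mem_univ _))
      (mem_extChartAt_target (I := 𝓡 n) x)
      (by rw [chartFun_extChartAt x f.1 hxs]; exact hx)
    filter_upwards [(continuousAt_extChartAt (I := 𝓡 n) x).eventually hev,
      (isOpen_extChartAt_source (I := 𝓡 n) x).mem_nhds hxs] with z hz hzs
    rwa [chartFun_extChartAt x f.1 hzs] at hz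
  have huniv := hclopen.eq_univ ⟨p, rfl⟩
  exact fun x => (huniv ▸ mem_univ x : x ∈ {x | ℓ (f.1 x 0) = ℓ (f.1 p 0)})

lemma extD_zero_eq_zero_of_closed [CompactSpace M] [ConnectedSpace M] {f : SmoothForm n M 0}
    {J : AlmostComplexStructure n M} (h : extD 1 (J.act 1 (extD 0 f)) = 0) : extD 0 f = 0 := by
  obtain ⟨a, ha⟩ := exists_const_of_closed h Complex.reCLM
  obtain ⟨b, hb⟩ := exists_const_of_closed h Complex.imCLM
  refine Subtype.ext (funext fun c =>
    apply_eq_zero_of_chartRep_eq_zero (mem_extChartAt_source (I := 𝓡 n) c) ?_)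
  have hconst : chartFun c f.1 = fun _ => (⟨a, b⟩ : ℂ) := by
    funext z
    rw [chartFun_eq]
    exact Complex.ext (ha _) (hb _)
  ext v
  rw [chartRep_extD_zero_apply c f (mem_extChartAt_target (I := 𝓡 n) c), hconst]
  simp

lemma conjForm_act {k : ℕ} (J : AlmostComplexStructure n M) (α : SmoothForm n M k) :
    J.act k (conjForm α) = conjForm (J.act k α) := rfl

lemma extD_conjForm {k : ℕ} (α : SmoothForm n M k) :
    extD k (conjForm α) = conjForm (extD k α) := by
  ext x v
  set y := extChartAt (𝓡 n) x x
  have hd := differentiableAt_chartRep α.2 x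
  have hd' := differentiableAt_chartRep (conjForm α).2 x
  suffices hs : ∀ w : Fin (k + 1) → Coord n, extDeriv (chartRep x (conjForm α).1) y w =
      (starRingEnd ℂ) (extDeriv (chartRep x α.1) y w) from hs _
  intro w
  rw [extDeriv_apply hd, extDeriv_apply hd', map_sum]
  refine Finset.sum_congr rfl fun i _ => ?_
  have h1 : DifferentiableAt ℝ (fun z => chartRep x α.1 z (i.removeNth w)) y :=
    (ContinuousAlternatingMap.apply ℝ (Coord n) ℂ (i.removeNth w)).differentiableAt.comp y hd
  have h2 : fderiv ℝ (fun z => chartRep x (conjForm α).1 z (i.removeNth w)) y (w i) =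
      (starRingEnd ℂ) (fderiv ℝ (fun z => chartRep x α.1 z (i.removeNth w)) y (w i)) :=
    DFunLike.congr_fun
      ((Complex.conjCLE : ℂ →L[ℝ] ℂ).hasFDerivAt.comp y h1.hasFDerivAt).fderiv (w i)
  rw [h2]
  exact (map_zsmul (starRingEnd ℂ) _ _).symm

lemma dc_eq_zero_iff (J : AlmostComplexStructure n M) {k : ℕ} (α : SmoothForm n M k) :
    J.dc k α = 0 ↔ extD k (J.act k α) = 0 :=
  (J.actEquiv (k + 1)).symm.map_eq_zero_iff

end Charts

/-! ### The space of harmonic `1`-forms -/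

section Harmonic

variable {n : ℕ} {M : Type*} [TopologicalSpace M] [ChartedSpace (Coord n) M]
  [IsManifold (𝓡 n) ∞ M] [T2Space M] [CompactSpace M]

lemma mem_harmonicOne_iff (J : AlmostComplexStructure n M) (g : Metric n M)
    (α : SmoothForm n M 1) :
    α ∈ harmonicOne J g ↔ extD 1 α = 0 ∧ extD 1 (J.act 1 α) = 0 := by
  rw [← dc_eq_zero_iff]
  exact ⟨closed_of_mem_harmonicOne, fun h => mem_harmonicOne_of_closed J g h.1 h.2⟩

lemma act_mem_harmonicOne {J : AlmostComplexStructure n M} {g : Metric n M}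
    {α : SmoothForm n M 1} (h : α ∈ harmonicOne J g) : J.act 1 α ∈ harmonicOne J g := by
  rw [mem_harmonicOne_iff] at h ⊢
  refine ⟨h.2, ?_⟩
  rw [J.act_act, map_smul, h.1, smul_zero]

lemma conjForm_mem_harmonicOne {J : AlmostComplexStructure n M} {g : Metric n M}
    {α : SmoothForm n M 1} (h : α ∈ harmonicOne J g) : conjForm α ∈ harmonicOne J g := by
  have h0 : conjForm (0 : SmoothForm n M 2) = 0 := by
    ext x v
    exact map_zero (starRingEnd ℂ)
  rw [mem_harmonicOne_iff] at h ⊢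
  rw [conjForm_act, extD_conjForm, extD_conjForm, h.1, h.2]
  exact ⟨h0, h0⟩

/-- On a line, `J` would act by a scalar of square `-1`, which commutation with conjugation forces
to be real. -/
lemma hOne_eq_zero_of_le_one {J : AlmostComplexStructure n M} {g : Metric n M}
    (h : hOne J g ≤ 1) : hOne J g = 0 := by
  have : Module.Free ℂ (harmonicOne J g) := Module.Free.of_divisionRing ℂ _
  obtain ⟨⟨α, hα⟩, hspan⟩ := rank_le_one_iff.1 h
  have hspan' : ∀ β ∈ harmonicOne J g, ∃ r : ℂ, r • α = β := fun β hβ => by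
    obtain ⟨r, hr⟩ := hspan ⟨β, hβ⟩
    exact ⟨r, congrArg Subtype.val hr⟩
  have hα0 : α = 0 := by
    by_contra hne
    obtain ⟨c, hc⟩ := hspan' _ (act_mem_harmonicOne hα)
    obtain ⟨b, hb⟩ := hspan' _ (conjForm_mem_harmonicOne hα)
    have hsq : c * c = -1 := by
      have h1 := J.act_act 1 α
      rw [← hc, map_smul, ← hc, smul_smul, pow_one] at h1
      exact smul_left_injective ℂ hne h1
    have hb0 : b ≠ 0 := by
      rintro rfl
      apply hne
      have h2 : conjForm α = 0 := by rw [← hb, zero_smul]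
      ext x v
      exact (starRingEnd ℂ).map_eq_zero_iff.1
        (DFunLike.congr_fun (congrFun (congrArg Subtype.val h2) x) v)
    have hreal : (starRingEnd ℂ) c = c := by
      have h3 := conjForm_act J α
      rw [← hb, map_smul, ← hc, conjForm_smul, ← hb, smul_smul, smul_smul] at h3
      have h4 : b * c = (starRingEnd ℂ) c * b := smul_left_injective ℂ hne h3
      exact mul_right_cancel₀ hb0 (by rw [← h4, mul_comm])
    obtain ⟨r, rfl⟩ := Complex.conj_eq_iff_real.1 hreal
    have h5 : r * r = -1 := by exact_mod_cast hsq
    nlinarith [mul_self_nonneg r]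
  refine rank_zero_iff_forall_zero.2 fun β => ?_
  obtain ⟨r, hr⟩ := hspan' β.1 β.2
  exact Subtype.ext (by rw [← hr, hα0, smul_zero]; rfl)

/-- The linear map `ℋ¹_{d+d^c} → H¹_dR` sending a harmonic form to its de Rham class. -/
noncomputable def harmonicClass (J : AlmostComplexStructure n M) (g : Metric n M) :
    harmonicOne J g →ₗ[ℂ] DeRhamOne n M :=
  deRhamClass ∘ₗ Submodule.inclusion fun _ hα => (closed_of_mem_harmonicOne hα).1

lemma harmonicClass_injective [ConnectedSpace M] (J : AlmostComplexStructure n M)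
    (g : Metric n M) : Function.Injective (harmonicClass J g) := by
  rw [injective_iff_map_eq_zero]
  rintro ⟨α, hα⟩ h
  obtain ⟨f, rfl⟩ : α ∈ exactOne n M :=
    (Submodule.Quotient.mk_eq_zero ((exactOne n M).submoduleOf (closedOne n M))).1 h
  exact Subtype.ext (extD_zero_eq_zero_of_closed ((mem_harmonicOne_iff J g _).1 hα).2)

end Harmonic

end AlmostComplex

theorem mainTheorem12 {m : ℕ} {M : Type*} [TopologicalSpace M]
    [ChartedSpace (EuclideanSpace ℝ (Fin (2 * m))) M] [IsManifold (𝓡 (2 * m)) ∞ M]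
    [T2Space M] [CompactSpace M] [ConnectedSpace M]
    (J : AlmostComplex.AlmostComplexStructure (2 * m) M)
    (g : AlmostComplex.Metric (2 * m) M) (hg : AlmostComplex.IsCompatible J g) :
    (∃ ι : AlmostComplex.harmonicOne J g →ₗ[ℂ] AlmostComplex.DeRhamOne (2 * m) M,
      Function.Injective ι ∧
      ∀ α : AlmostComplex.harmonicOne J g,
        ∃ hα : α.1 ∈ AlmostComplex.closedOne (2 * m) M,
          ι α = AlmostComplex.deRhamClass ⟨α.1, hα⟩) ∧
    AlmostComplex.hOne J g ≤ AlmostComplex.bettiOne (2 * m) M ∧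
    (AlmostComplex.bettiOne (2 * m) M = 0 ∨ AlmostComplex.bettiOne (2 * m) M = 1 →
      AlmostComplex.hOne J g = 0) := by
  have hinj := AlmostComplex.harmonicClass_injective J g
  have hle : AlmostComplex.hOne J g ≤ AlmostComplex.bettiOne (2 * m) M :=
    LinearMap.rank_le_of_injective _ hinj
  refine ⟨⟨AlmostComplex.harmonicClass J g, hinj, fun α =>
    ⟨(AlmostComplex.closed_of_mem_harmonicOne α.2).1, rfl⟩⟩, hle, ?_⟩
  rintro (h | h)
  · exact le_antisymm (h ▸ hle) zero_le
  · exact AlmostComplex.hOne_eq_zero_of_le_one (h ▸ hle)
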